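/- Let $N,p\ge 0$ be integers. A configuration of $m$ vicious random-turns walkers with $2N$ steps consists of $m$ walkers which start on the sites $1,2,\dots,m$ of the half line $\{l\in\mathbb Z: l\ge 1\}$; at each of the time steps $1,\dots,2N$ exactly one walker moves, to one of its two neighbouring sites; no walker ever leaves the half line and no two walkers ever occupy the same site; and after step $2N$ every walker is back on its starting site. Label the walkers $1,\dots,m$ from right to left and let $n_j(t)$ be the displacement of walker $j$ from its starting site after $t$ steps. First class: the configurations with exactly $m=p$ walkers. Second class, for a fixed integer $N^*\ge N$: the configurations with $m=N^*$ walkers in which the right-most walker is at all times displaced by at most $p$ sites, $|n_1(t)|\le p$ for all $t$ (no condition if $N^*=0$). Let $\mathcal I_{N,p}$ be the set of fixed point free involutions of $\{1,\dots,2N\}$ (permutations consisting solely of two-cycles) whose longest decreasing subsequence has length at most $2p$. Then each of the two classes is in bijection with $\mathcal I_{N,p}$. More precisely, for every configuration $c$ of the first (respectively second) class there is exactly one involution $\sigma$ of $\{1,\dots,2N\}$ for which there are numbered Young diagrams $\emptyset=T_0,T_1,\dots,T_{2N}=\emptyset$, with entries from $\{1,\dots,2N\}$ strictly increasing down columns and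 across rows, such that (i) the length of row $j$ (respectively column $j$) of $T_t$ is $n_j(t)$ for $1\le j\le m$, and is $0$ for $j>m$; (ii) for each $t=1,\dots,2N$, either $\sigma(t)>t$ and $T_t$ arises from $T_{t-1}$ by adding a box numbered $t$, or $\sigma(t)<t$ and $T_t$ arises from $T_{t-1}$ by the reverse column insertion that ejects $\sigma(t)$, i.e. Schensted column insertion of $\sigma(t)$ into $T_t$ gives $T_{t-1}$. The map $c\mapsto\sigma$ is a bijection from the first (respectively second) class onto $\mathcal I_{N,p}$. -/

import Mathlib

/-- A configuration of `m` vicious random-turns walkers on the half line `l ≥ 1` during `n` time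
steps, starting on the sites `1, …, m` and returning to them.  `pos t j` is the site at time `t` of
the `j`-th walker counted from the left (`j = 0, …, m - 1`). -/
@[ext]
structure WalkerConfig (m n : ℕ) where
  pos : Fin (n + 1) → Fin m → ℤ
  start : ∀ j, pos 0 j = (j : ℤ) + 1
  finish : ∀ j, pos (Fin.last n) j = (j : ℤ) + 1
  /-- no two walkers ever occupy the same site, and they keep their order -/
  vicious : ∀ t, StrictMono (pos t)
  /-- the walkers stay in the region `l ≥ 1` -/
  wall : ∀ t j, 1 ≤ pos t j
  /-- at each time step exactly one walker moves, to one of its two neighbouring sites -/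
  step : ∀ t : Fin n, ∃ j,
    (pos t.succ j = pos t.castSucc j + 1 ∨ pos t.succ j = pos t.castSucc j - 1) ∧
      ∀ k, k ≠ j → pos t.succ k = pos t.castSucc k

/-- The displacement at time `t` of the walker with label `j`, the walkers being labelled
`0, …, m - 1` from the right (so `0` is the right-most walker, which starts at site `m`);
it is `0` for the labels `j ≥ m`, which belong to no walker. -/
def WalkerConfig.disp {m n : ℕ} (c : WalkerConfig m n) (t : Fin (n + 1)) (j : ℕ) : ℤ :=
  if h : j < m then c.pos t (Fin.rev ⟨j, h⟩) - c.pos 0 (Fin.rev ⟨j, h⟩) else 0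

/-- The first class: exactly `p` walkers, `2 * N` steps. -/
abbrev FirstClass (N p : ℕ) : Type := WalkerConfig p (2 * N)

/-- The second class: `M` walkers, `2 * N` steps, and the right-most walker is never displaced by
more than `p` sites from its initial position. -/
abbrev SecondClass (N p M : ℕ) : Type :=
  {c : WalkerConfig M (2 * N) // ∀ t, |c.disp t 0| ≤ (p : ℤ)}

/-- A permutation consisting solely of two-cycles. -/
def IsFixedPointFreeInvolution {n : ℕ} (σ : Equiv.Perm (Fin n)) : Prop :=
  ∀ i, σ i ≠ i ∧ σ (σ i) = i

open Classical in
/-- The maximal length of a decreasing subsequence of `σ 0, σ 1, …, σ (n - 1)`. -/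
noncomputable def maxDecreasingLength {n : ℕ} (σ : Equiv.Perm (Fin n)) : ℕ :=
  (Finset.univ.filter fun s : Finset (Fin n) => StrictAntiOn σ (s : Set (Fin n))).sup Finset.card

/-- The fixed point free involutions of a set of `2 * N` ordered elements (here `Fin (2 * N)`)
whose longest decreasing subsequence has length at most `2 * p`. -/
abbrev BoundedInvolution (N p : ℕ) : Type :=
  {σ : Equiv.Perm (Fin (2 * N)) //
    IsFixedPointFreeInvolution σ ∧ maxDecreasingLength σ ≤ 2 * p}

/-- A numbered diagram, given as the list of its columns from left to right, each column being
the list of its entries from top to bottom. -/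
abbrev Tableau (α : Type*) : Type _ := List (List α)

namespace Tableau

variable {α : Type*}

/-- The length of column `j` (columns are counted from `0`). -/
def colLen (T : Tableau α) (j : ℕ) : ℕ := (T.getD j []).length

/-- The length of row `i` (rows are counted from `0`). -/
def rowLen (T : Tableau α) (i : ℕ) : ℕ := T.countP fun c => i < c.length

variable [LinearOrder α]

/-- The shape is a Young diagram, and the entries strictly increase down each column and
across each row. -/
def IsStandard (T : Tableau α) : Prop :=
  (∀ c ∈ T, c ≠ [] ∧ c.Pairwise (· < ·)) ∧
    T.IsChain fun u v => v.length ≤ u.length ∧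
      ∀ (i : ℕ) (x y : α), u[i]? = some x → v[i]? = some y → x < y

/-- `AddBox x S T`: the numbered diagram `T` is `S` with a box numbered `x` added at the
bottom of one column, or as a new last column. -/
inductive AddBox (x : α) : Tableau α → Tableau α → Prop
  | new : AddBox x [] [[x]]
  | here (c : List α) (S : Tableau α) : AddBox x (c :: S) ((c ++ [x]) :: S)
  | there (c : List α) {S T : Tableau α} : AddBox x S T → AddBox x (c :: S) (c :: T)

/-- Inserting `x` into one column: `x` replaces the top-most entry `y ≥ x`, which is bumped out,
or is put at the bottom if there is no such entry. -/
def colBump (x : α) : List α → List α × Option α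
  | [] => ([x], none)
  | y :: c => if x ≤ y then (x :: c, some y) else (y :: (colBump x c).1, (colBump x c).2)

/-- Schensted column insertion: `x` is inserted into the first column, an entry that is bumped out
is inserted into the next column, and so on. -/
def colInsert (x : α) : Tableau α → Tableau α
  | [] => [[x]]
  | c :: T =>
    match colBump x c with
    | (c', none) => c' :: T
    | (c', some y) => c' :: colInsert y T

end Tableau

/-- `IsSundaramRun T σ`: the sequence `T` of numbered diagrams starts and ends with the empty
diagram; at step `t` either a box numbered `t` is added, or a box is removed by reverse
column insertion, an entry `x < t` being ejected (that is, column inserting `x` restores the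
diagram before the step); and the involution `σ` is the one whose two-cycles are the pairs
`(t, x)` so obtained.  The steps `t` are numbered by `Fin n`. -/
def IsSundaramRun {n : ℕ} (T : Fin (n + 1) → Tableau (Fin n)) (σ : Equiv.Perm (Fin n)) : Prop :=
  T 0 = [] ∧ T (Fin.last n) = [] ∧ (∀ t, (T t).IsStandard) ∧ (∀ i, σ (σ i) = i) ∧
    ∀ t : Fin n,
      (t < σ t ∧ Tableau.AddBox t (T t.castSucc) (T t.succ)) ∨
        (σ t < t ∧ T t.castSucc = Tableau.colInsert (σ t) (T t.succ))

/-- `σ` is obtained from the walker configuration `c` through the oscillating tableau in which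
the length of *row* `j` is the displacement of walker `j`. -/
def RowCorrespondence {m n : ℕ} (c : WalkerConfig m n) (σ : Equiv.Perm (Fin n)) : Prop :=
  ∃ T : Fin (n + 1) → Tableau (Fin n),
    (∀ t j, ((T t).rowLen j : ℤ) = c.disp t j) ∧ IsSundaramRun T σ

/-- `σ` is obtained from the walker configuration `c` through the oscillating tableau in which
the length of *column* `j` is the displacement of walker `j`. -/
def ColumnCorrespondence {m n : ℕ} (c : WalkerConfig m n) (σ : Equiv.Perm (Fin n)) : Prop :=
  ∃ T : Fin (n + 1) → Tableau (Fin n),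
    (∀ t j, ((T t).colLen j : ℤ) = c.disp t j) ∧ IsSundaramRun T σ

set_option linter.unusedSectionVars false

/-! Read from right to left, the displacements form a partition: the exclusion of collisions makes
them weakly decreasing, the wall makes them nonnegative, and a move adds or removes one box. A
configuration is thus an oscillating sequence of shapes from ∅ to ∅ with at most `m` parts
(`WalkerConfig.exists_isShapeWalk`, `IsShapeWalk.exists_walkerConfig`).

Such sequences match fixed point free involutions by Sundaram's correspondence. Forwards in time the
shapes determine the fillings: a growing step writes `t` into the new box, a shrinking step starts
reverse column insertion at the vanishing corner (`IsStandard.exists_colInsert_eq`, unique by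
`colInsert_inj`). Every entry is written once and, since the last diagram is empty, ejected once;
pairing the two times gives `σ`. Backwards in time `σ` determines the fillings: insert `σ t` if `σ t
< t`, erase the largest entry `t` otherwise (`exists_isSundaramRun`,
`IsSundaramRun.unique_tableau`).

For the bound, the reversed run is column insertion of the values `σ t`, interrupted by deletions of
the current maximum. By Schensted's argument, and because deleting a maximum does not affect counts
of smaller entries, the first column of `T t` is as long as the largest family of mutually nested
two-cycles straddling time `t` (`IsSundaramRun.isGreatest_countP`). A nested family of `k`
two-cycles is a decreasing subsequence of length `2k`, and half of any decreasing subsequence comes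
from such a family; hence `p` for columns corresponds to `2p` for subsequences. The length of the
first column is the number of rows, bounded by the number of walkers in the first class, and it is
the displacement of the right-most walker in the second. -/

namespace Tableau

/-! ### Standard tableaux as lists of columns -/

variable {α : Type*} [LinearOrder α]

/-- The relation between neighbouring columns of a standard tableau. -/
def RowLt (u v : List α) : Prop :=
  v.length ≤ u.length ∧ ∀ (i : ℕ) (x y : α), u[i]? = some x → v[i]? = some y → x < y

lemma rowLt_nil (u : List α) : RowLt u [] := by simp [RowLt]

lemma isStandard_nil : IsStandard ([] : Tableau α) := by simp [IsStandard]

lemma isStandard_cons {c : List α} {T : Tableau α} :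
    IsStandard (c :: T) ↔
      c ≠ [] ∧ c.Pairwise (· < ·) ∧ RowLt c (T.headD []) ∧ IsStandard T := by
  cases T with
  | nil => simp [IsStandard, rowLt_nil]
  | cons d T =>
    simp only [IsStandard, List.forall_mem_cons, List.isChain_cons_cons, List.headD_cons, RowLt]
    tauto

@[simp] lemma colLen_nil (j : ℕ) : colLen ([] : Tableau α) j = 0 := by simp [colLen]

@[simp] lemma colLen_cons_zero (c : List α) (T : Tableau α) : colLen (c :: T) 0 = c.length := by
  simp [colLen]

@[simp] lemma colLen_cons_succ (c : List α) (T : Tableau α) (j : ℕ) :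
    colLen (c :: T) (j + 1) = colLen T j := by
  simp [colLen]

lemma colLen_zero (T : Tableau α) : colLen T 0 = (T.headD []).length := by
  cases T <;> simp

lemma IsStandard.colLen_succ_le {T : Tableau α} (h : IsStandard T) (j : ℕ) :
    colLen T (j + 1) ≤ colLen T j := by
  induction T generalizing j with
  | nil => simp
  | cons c T ih =>
    obtain ⟨_, _, h3, h4⟩ := isStandard_cons.1 h
    cases j with
    | zero => simpa [colLen_zero] using h3.1
    | succ j => simpa using ih h4 j

lemma IsStandard.eq_nil {T : Tableau α} (h : IsStandard T) (h0 : T.flatten = []) : T = [] := by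
  cases T with
  | nil => rfl
  | cons c T => exact absurd (List.append_eq_nil_iff.1 h0).1 (isStandard_cons.1 h).1

lemma IsStandard.headD_pairwise {T : Tableau α} (h : IsStandard T) :
    (T.headD []).Pairwise (· < ·) := by
  cases T with
  | nil => simp
  | cons c T => exact (isStandard_cons.1 h).2.1

lemma mem_flatten_of_mem_headD {T : Tableau α} {x : α} (h : x ∈ T.headD []) : x ∈ T.flatten := by
  cases T with
  | nil => simp at h
  | cons c T => simp at h; simp [h]

lemma lt_of_getElem? {u : List α} (hc : u.Pairwise (· < ·)) {i j : ℕ} {a b : α}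
    (ha : u[i]? = some a) (hb : u[j]? = some b) (hij : i < j) : a < b := by
  obtain ⟨hi, rfl⟩ := List.getElem?_eq_some_iff.1 ha
  obtain ⟨hj, rfl⟩ := List.getElem?_eq_some_iff.1 hb
  exact List.pairwise_iff_getElem.1 hc _ _ hi hj hij

lemma le_of_getElem? {u : List α} (hc : u.Pairwise (· < ·)) {i j : ℕ} {a b : α}
    (ha : u[i]? = some a) (hb : u[j]? = some b) (hij : i ≤ j) : a ≤ b := by
  rcases hij.lt_or_eq with h | rfl
  · exact (lt_of_getElem? hc ha hb h).le
  · rw [ha] at hb; exact (Option.some.inj hb).le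

lemma getElem?_replace (l r : List α) (x y : α) (i : ℕ) :
    (l ++ x :: r)[i]? = if i = l.length then some x else (l ++ y :: r)[i]? := by
  split_ifs with h
  · subst h; simp
  · rcases lt_or_gt_of_ne h with h | h
    · simp [List.getElem?_append_left h]
    · rw [List.getElem?_append_right h.le, List.getElem?_append_right h.le]
      obtain ⟨k, hk⟩ : ∃ k, i - l.length = k + 1 := ⟨i - l.length - 1, by omega⟩
      simp [hk]

/-! ### Column insertion -/

lemma colBump_append {x : α} {c : List α} (h : ∀ a ∈ c, a < x) :
    colBump x c = (c ++ [x], none) := by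
  induction c with
  | nil => rfl
  | cons a c ih =>
    simp only [List.forall_mem_cons] at h
    simp [colBump, not_le.2 h.1, ih h.2]

lemma colBump_replace {x y : α} {l r : List α} (h : ∀ a ∈ l, a < x) (hxy : x ≤ y) :
    colBump x (l ++ y :: r) = (l ++ x :: r, some y) := by
  induction l with
  | nil => simp [colBump, hxy]
  | cons a c ih =>
    simp only [List.forall_mem_cons] at h
    simp [colBump, not_le.2 h.1, ih h.2]

lemma colBump_cases (x : α) (c : List α) :
    (∀ a ∈ c, a < x) ∨ ∃ l y r, c = l ++ y :: r ∧ x ≤ y ∧ ∀ a ∈ l, a < x := by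
  induction c with
  | nil => simp
  | cons a c ih =>
    by_cases h : x ≤ a
    · exact Or.inr ⟨[], a, c, rfl, h, by simp⟩
    · rcases ih with ih | ⟨l, y, r, rfl, hy, hl⟩
      · left; simpa [not_le.1 h] using ih
      · exact Or.inr ⟨a :: l, y, r, rfl, hy, by simpa [not_le.1 h] using hl⟩

lemma colInsert_append {x : α} {c : List α} (T : Tableau α) (h : ∀ a ∈ c, a < x) :
    colInsert x (c :: T) = (c ++ [x]) :: T := by
  simp [colInsert, colBump_append h]

lemma colInsert_replace {x y : α} {l r : List α} (T : Tableau α) (h : ∀ a ∈ l, a < x)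
    (hxy : x ≤ y) : colInsert x ((l ++ y :: r) :: T) = (l ++ x :: r) :: colInsert y T := by
  simp [colInsert, colBump_replace h hxy]

lemma headD_colInsert (x : α) (T : Tableau α) :
    (colInsert x T).headD [] = (colBump x (T.headD [])).1 := by
  cases T with
  | nil => rfl
  | cons c T =>
    rcases colBump_cases x c with h | ⟨l, y, r, rfl, hy, hl⟩
    · simp [colInsert_append T h, colBump_append h]
    · simp [colInsert_replace T hl hy, colBump_replace hl hy]

lemma colInsert_perm (x : α) (T : Tableau α) : (colInsert x T).flatten.Perm (x :: T.flatten) := by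
  induction T generalizing x with
  | nil => simp [colInsert]
  | cons c T ih =>
    rcases colBump_cases x c with h | ⟨l, y, r, rfl, hy, hl⟩
    · rw [colInsert_append T h]
      simp only [List.flatten_cons, List.append_assoc, List.singleton_append]
      exact List.perm_middle
    · rw [colInsert_replace T hl hy]
      simp only [List.flatten_cons, List.append_assoc, List.cons_append]
      refine List.perm_middle.trans (List.Perm.cons _ ?_)
      refine List.Perm.append_left _ ((List.Perm.append_left _ (ih y)).trans List.perm_middle)

lemma colLen_colInsert (x : α) (T : Tableau α) :
    ∃ k, ∀ j, colLen (colInsert x T) j = colLen T j + if j = k then 1 else 0 := by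
  induction T generalizing x with
  | nil => exact ⟨0, fun j => by cases j <;> simp [colInsert]⟩
  | cons c T ih =>
    rcases colBump_cases x c with h | ⟨l, y, r, rfl, hy, hl⟩
    · rw [colInsert_append T h]
      exact ⟨0, fun j => by cases j <;> simp⟩
    · rw [colInsert_replace T hl hy]
      obtain ⟨k, hk⟩ := ih y
      exact ⟨k + 1, fun j => by cases j <;> simp [hk]⟩

lemma RowLt.append {u v : List α} (h : RowLt u v) (w : List α) : RowLt (u ++ w) v := by
  refine ⟨by simpa using h.1.trans (Nat.le_add_right _ _), fun i x y hx hy => h.2 i x y ?_ hy⟩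
  have hi := (List.getElem?_eq_some_iff.1 hy).1
  rwa [List.getElem?_append_left (hi.trans_le h.1)] at hx

/-- The bumped entry `y` moves weakly upwards: an entry of `v` in the old row of `y` exceeds `y`.
Its new left neighbour is therefore either `x` or an entry that stood above `y`, and both are
smaller than `y`. -/
lemma RowLt.bump {l r v : List α} {x y : α} (h : RowLt (l ++ y :: r) v)
    (hc : (l ++ y :: r).Pairwise (· < ·)) (hxy : x < y) :
    RowLt (l ++ x :: r) (colBump y v).1 := by
  have hget := getElem?_replace l r x y
  have hy : (l ++ y :: r)[l.length]? = some y := by simp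
  have hle : ∀ (i : ℕ) (a : α), i ≤ l.length → (l ++ x :: r)[i]? = some a → a < y := by
    intro i a hi ha
    rw [hget] at ha
    split_ifs at ha with hil
    · exact (Option.some.inj ha) ▸ hxy
    · exact lt_of_getElem? hc ha hy (lt_of_le_of_ne hi hil)
  have hmono : ∀ (i : ℕ) (a b : α), (l ++ x :: r)[i]? = some a → v[i]? = some b → a < b := by
    intro i a b ha hb
    rw [hget] at ha
    split_ifs at ha with hil
    · subst hil
      exact (Option.some.inj ha) ▸ hxy.trans (h.2 _ _ _ hy hb)
    · exact h.2 _ _ _ ha hb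
  have hlen := h.1
  simp only [List.length_append, List.length_cons] at hlen
  rcases colBump_cases y v with hv | ⟨l', z, r', rfl, hz, hl'⟩
  · rw [colBump_append hv]
    have hvl : v.length ≤ l.length := by
      by_contra! hlt
      have := h.2 _ _ _ hy (List.getElem?_eq_getElem hlt)
      exact absurd (hv _ (List.getElem_mem hlt)) this.not_gt
    refine ⟨by simp; omega, fun i a b ha hb => ?_⟩
    simp only at hb
    rcases lt_or_ge i v.length with hi | hi
    · rw [List.getElem?_append_left hi] at hb
      exact hmono i a b ha hb
    · rw [List.getElem?_append_right hi, List.getElem?_singleton] at hb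
      split_ifs at hb with h0
      obtain rfl := Option.some.inj hb
      exact hle i a (by omega) ha
  · rw [colBump_replace hl' hz]
    have hvl : l'.length ≤ l.length := by
      by_contra! hlt
      have := h.2 _ _ _ hy (by rw [List.getElem?_append_left hlt]; exact List.getElem?_eq_getElem hlt)
      exact absurd (hl' _ (List.getElem_mem hlt)) this.not_gt
    refine ⟨by simpa using hlen, fun i a b ha hb => ?_⟩
    simp only [getElem?_replace l' r' y z] at hb
    split_ifs at hb with hi
    · obtain rfl := Option.some.inj hb
      exact hle i a (by omega) ha
    · exact hmono i a b ha hb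

lemma pairwise_replace {l r : List α} {x y : α} (hc : (l ++ y :: r).Pairwise (· < ·))
    (hl : ∀ a ∈ l, a < x) (hr : ∀ a ∈ r, x < a) : (l ++ x :: r).Pairwise (· < ·) := by
  rw [List.pairwise_append, List.pairwise_cons] at hc ⊢
  refine ⟨hc.1, ⟨hr, hc.2.1.2⟩, fun a ha b hb => ?_⟩
  rcases List.mem_cons.1 hb with rfl | hb
  · exact hl a ha
  · exact hc.2.2 a ha b (List.mem_cons_of_mem _ hb)

lemma IsStandard.colInsert {T : Tableau α} (h : IsStandard T) {x : α}
    (hn : (x :: T.flatten).Nodup) : IsStandard (colInsert x T) := by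
  induction T generalizing x with
  | nil => simp [Tableau.colInsert, isStandard_cons, rowLt_nil, isStandard_nil]
  | cons c T ih =>
    obtain ⟨h1, h2, h3, h4⟩ := isStandard_cons.1 h
    rcases colBump_cases x c with hx | ⟨l, y, r, rfl, hy, hl⟩
    · rw [colInsert_append T hx, isStandard_cons]
      refine ⟨by simp, ?_, h3.append _, h4⟩
      rw [List.pairwise_append]
      exact ⟨h2, by simp, by simpa using hx⟩
    · rw [colInsert_replace T hl hy, isStandard_cons, headD_colInsert]
      have hxy : x < y := by
        refine lt_of_le_of_ne hy ?_
        rintro rfl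
        simp at hn
      have hyr : ∀ a ∈ r, y < a := (List.pairwise_cons.1 (List.pairwise_append.1 h2).2.1).1
      refine ⟨by simp, pairwise_replace h2 hl fun a ha => hxy.trans (hyr a ha),
        h3.bump h2 hxy, ih h4 ?_⟩
      have hs : (y :: T.flatten).Sublist ((l ++ y :: r) :: T).flatten := by
        simp only [List.flatten_cons, List.append_assoc, List.cons_append]
        exact ((List.sublist_append_right _ _).cons_cons _).trans (List.sublist_append_right _ _)
      exact (List.nodup_cons.1 hn).2.sublist hs

/-! ### Reverse column insertion -/

/-- Undoing a bump keeps rows strict. Since the entries below `z` exceed `y`, strictness of the rows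
forces `y` to sit in the right column no lower than the row of `z`. So whatever stands beside the
restored `y` is at least the entry `w` that regains its place, and `w > y`. -/
lemma RowLt.of_bump {l r v : List α} {z y : α} (hv : v.Pairwise (· < ·))
    (hv' : (colBump y v).1.Pairwise (· < ·)) (hn : y ∉ v)
    (h : RowLt (l ++ z :: r) (colBump y v).1) (hr : ∀ a ∈ r, y < a) :
    RowLt (l ++ y :: r) v := by
  have hget := getElem?_replace l r y z
  have hrget : ∀ (i : ℕ) (a : α), l.length < i → (l ++ z :: r)[i]? = some a → y < a := by
    intro i a hi ha
    rw [List.getElem?_append_right hi.le] at ha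
    obtain ⟨k, hk⟩ : ∃ k, i - l.length = k + 1 := ⟨i - l.length - 1, by omega⟩
    rw [hk, List.getElem?_cons_succ] at ha
    exact hr a (List.mem_of_getElem? ha)
  rcases colBump_cases y v with hvy | ⟨l', w, r', rfl, hw, hl'⟩
  · rw [colBump_append hvy] at h hv'
    have hlen := h.1
    simp only [List.length_append, List.length_cons, List.length_nil] at hlen
    have hvl : v.length ≤ l.length := by
      by_contra! hlt
      have hlt' : v.length < (l ++ z :: r).length := by simp; omega
      have h1 := hrget v.length _ hlt (List.getElem?_eq_getElem hlt')
      have h2 := h.2 v.length _ y (List.getElem?_eq_getElem hlt') (by simp)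
      exact absurd h1 h2.not_gt
    refine ⟨by simp; omega, fun i a b ha hb => ?_⟩
    have hi := (List.getElem?_eq_some_iff.1 hb).1
    rw [hget, if_neg (by omega)] at ha
    exact h.2 i a b ha (by simpa [List.getElem?_append_left hi] using hb)
  · rw [colBump_replace hl' hw] at h hv'
    have hwy : y < w := lt_of_le_of_ne hw (by rintro rfl; simp at hn)
    have hlen := h.1
    simp only [List.length_append, List.length_cons] at hlen
    have hvl : l'.length ≤ l.length := by
      by_contra! hlt
      have hlt' : l'.length < (l ++ z :: r).length := by simp; omega
      have h1 := hrget l'.length _ hlt (List.getElem?_eq_getElem hlt')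
      have h2 := h.2 l'.length _ y (List.getElem?_eq_getElem hlt') (by simp)
      exact absurd h1 h2.not_gt
    refine ⟨by simpa using hlen, fun i a b ha hb => ?_⟩
    rw [hget] at ha
    have hw' : (l' ++ w :: r')[l'.length]? = some w := by simp
    split_ifs at ha with hi
    · obtain rfl := Option.some.inj ha
      exact hwy.trans_le (le_of_getElem? hv hw' hb (by omega))
    · rw [getElem?_replace l' r' w y] at hb
      split_ifs at hb with hi'
      · obtain rfl := Option.some.inj hb
        exact (h.2 i a y ha (by simp [hi'])).trans hwy
      · exact h.2 i a b ha hb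

lemma exists_last_lt {c : List α} (hc : c.Pairwise (· < ·)) {y : α} (hy : y ∉ c)
    (h0 : ∃ a ∈ c, a < y) :
    ∃ l z r, c = l ++ z :: r ∧ z < y ∧ (∀ a ∈ l, a < z) ∧ ∀ a ∈ r, y < a := by
  induction c with
  | nil => simp at h0
  | cons a c ih =>
    rw [List.pairwise_cons] at hc
    simp only [List.mem_cons, not_or] at hy
    by_cases h : ∃ b ∈ c, b < y
    · obtain ⟨l, z, r, rfl, hz, hl, hr⟩ := ih hc.2 hy.2 h
      exact ⟨a :: l, z, r, rfl, hz, by simpa using ⟨hc.1 z (by simp), hl⟩, hr⟩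
    · push Not at h
      refine ⟨[], a, c, rfl, ?_, by simp, fun b hb => lt_of_le_of_ne (h b hb) ?_⟩
      · obtain ⟨b, hb, hby⟩ := h0
        rcases List.mem_cons.1 hb with rfl | hb
        · exact hby
        · exact absurd hby (h b hb).not_gt
      · rintro rfl
        exact hy.2 hb

lemma IsStandard.head_lt {a : α} {c : List α} {T : Tableau α} (h : IsStandard ((a :: c) :: T))
    {y : α} (hy : y ∈ T.flatten) : a < y := by
  induction T generalizing a c with
  | nil => simp at hy
  | cons d T ih =>
    obtain ⟨-, -, h3, h4⟩ := isStandard_cons.1 h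
    obtain ⟨hd, hd', -, -⟩ := isStandard_cons.1 h4
    obtain ⟨b, d, rfl⟩ := List.exists_cons_of_ne_nil hd
    have hab : a < b := h3.2 0 a b rfl rfl
    rw [List.flatten_cons, List.mem_append, List.mem_cons] at hy
    rcases hy with (rfl | hy) | hy
    · exact hab
    · exact hab.trans ((List.pairwise_cons.1 hd').1 y hy)
    · exact hab.trans (ih h4 hy)

/-- Reverse column insertion, starting at the corner at the bottom of column `k`. -/
lemma IsStandard.exists_colInsert_eq {T : Tableau α} (h : IsStandard T) (hn : T.flatten.Nodup)
    {k : ℕ} (hk : colLen T (k + 1) < colLen T k) :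
    ∃ x T', IsStandard T' ∧ Tableau.colInsert x T' = T ∧
      ∀ j, colLen T j = colLen T' j + if j = k then 1 else 0 := by
  induction T generalizing k with
  | nil => simp at hk
  | cons c T ih =>
    obtain ⟨h1, h2, h3, h4⟩ := isStandard_cons.1 h
    cases k with
    | zero =>
      obtain ⟨l, x, rfl⟩ := List.eq_nil_or_concat' c |>.resolve_left h1
      rw [colLen_cons_succ, colLen_cons_zero, colLen_zero, List.length_append,
        List.length_singleton] at hk
      have hl : ∀ a ∈ l, a < x := by
        have := (List.pairwise_append.1 h2).2.2
        simpa using this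
      by_cases hl0 : l = []
      · subst hl0
        have : T = [] := by
          cases T with
          | nil => rfl
          | cons d T =>
            have := (isStandard_cons.1 h4).1
            simp at hk
            exact absurd hk this
        subst this
        exact ⟨x, [], isStandard_nil, rfl, fun j => by cases j <;> simp⟩
      · refine ⟨x, l :: T, isStandard_cons.2 ⟨hl0, (List.pairwise_append.1 h2).1, ⟨by omega, ?_⟩, h4⟩,
          colInsert_append T hl, fun j => by cases j <;> simp⟩
        intro i a b ha hb
        refine h3.2 i a b ?_ hb
        rw [List.getElem?_append_left (List.getElem?_eq_some_iff.1 ha).1, ha]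
    | succ k =>
      simp only [colLen_cons_succ] at hk
      rw [List.flatten_cons, List.nodup_append] at hn
      obtain ⟨y, T', hT', hy, hlen⟩ := ih h4 hn.2.1 hk
      have hp := colInsert_perm y T'
      rw [hy] at hp
      have hyT : y ∈ T.flatten := hp.mem_iff.2 (by simp)
      have hyn : y ∉ T'.flatten := (List.nodup_cons.1 (hp.nodup_iff.1 hn.2.1)).1
      have hyc : y ∉ c := fun hc => hn.2.2 y hc y hyT rfl
      -- The top-left entry is smaller than everything in later columns, so reverse bumping can
      -- always continue to the left.
      have hex : ∃ a ∈ c, a < y := by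
        obtain ⟨a, c, rfl⟩ := List.exists_cons_of_ne_nil h1
        exact ⟨a, by simp, h.head_lt hyT⟩
      obtain ⟨l, z, r, rfl, hz, hl, hr⟩ := exists_last_lt h2 hyc hex
      have hhead : T.headD [] = (colBump y (T'.headD [])).1 := by rw [← hy, headD_colInsert]
      refine ⟨z, (l ++ y :: r) :: T', isStandard_cons.2 ⟨by simp, ?_, ?_, hT'⟩, ?_, ?_⟩
      · exact pairwise_replace h2 (fun a ha => (hl a ha).trans hz) hr
      · rw [hhead] at h3
        exact RowLt.of_bump hT'.headD_pairwise (hhead ▸ h4.headD_pairwise)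
          (fun hm => hyn (mem_flatten_of_mem_headD hm)) h3 hr
      · rw [colInsert_replace T' hl hz.le, hy]
      · intro j
        cases j with
        | zero => simp
        | succ j => simp [hlen]

/-- The place of the bump can be read off the resulting column and the bumped entry `y`: it is the
last entry that is at most `y`, which filtering by `≤ y` isolates. -/
lemma append_cons_inj {l r l' r' : List α} {x x' y : α} (h : l ++ x :: r = l' ++ x' :: r')
    (hx : x ≤ y) (hx' : x' ≤ y) (hl : ∀ a ∈ l, a < x) (hl' : ∀ a ∈ l', a < x')
    (hr : ∀ a ∈ r, y < a) (hr' : ∀ a ∈ r', y < a) : l = l' ∧ x = x' ∧ r = r' := by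
  have key : ∀ (l r : List α) (x : α), x ≤ y → (∀ a ∈ l, a < x) → (∀ a ∈ r, y < a) →
      (l ++ x :: r).filter (· ≤ y) = l ++ [x] := by
    intro l r x hx hl hr
    rw [List.filter_append, List.filter_cons, if_pos (by simpa using hx),
      List.filter_eq_self.2 (fun a ha => by simpa using ((hl a ha).le.trans hx)),
      List.filter_eq_nil_iff.2 (fun a ha => by simpa using hr a ha)]
  have h1 := key l r x hx hl hr
  rw [h, key l' r' x' hx' hl' hr'] at h1
  obtain ⟨rfl, h2⟩ := List.append_inj' h1 rfl
  obtain rfl := List.singleton_inj.1 h2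
  simpa using h

/-- Equal shapes before insertion tell whether the first column grew. If it did, the inserted entry
is at its bottom; if not, induction on the remaining columns recovers the bumped entry, and this
locates the bump. -/
lemma colInsert_inj {S T : Tableau α} (hS : IsStandard S) (hT : IsStandard T) {x y : α}
    (h : colInsert x S = colInsert y T) (hlen : ∀ j, colLen S j = colLen T j) :
    x = y ∧ S = T := by
  induction S generalizing T x y with
  | nil =>
    cases T with
    | nil => simpa [colInsert] using h
    | cons d T =>
      have := hlen 0
      simp only [colLen_nil, colLen_cons_zero] at this
      exact absurd (List.length_eq_zero_iff.1 this.symm) (isStandard_cons.1 hT).1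
  | cons c S ih =>
    cases T with
    | nil =>
      have := hlen 0
      simp only [colLen_nil, colLen_cons_zero] at this
      exact absurd (List.length_eq_zero_iff.1 this) (isStandard_cons.1 hS).1
    | cons d T =>
      have h0 := hlen 0
      simp only [colLen_cons_zero] at h0
      obtain ⟨-, hc, -, hS'⟩ := isStandard_cons.1 hS
      obtain ⟨-, hd, -, hT'⟩ := isStandard_cons.1 hT
      rcases colBump_cases x c with hx | ⟨l, u, r, rfl, hu, hl⟩ <;>
      rcases colBump_cases y d with hy | ⟨l', u', r', rfl, hu', hl'⟩
      · rw [colInsert_append S hx, colInsert_append T hy, List.cons.injEq] at h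
        obtain ⟨h1, rfl⟩ := h
        obtain ⟨rfl, h2⟩ := List.append_inj' h1 rfl
        exact ⟨List.singleton_inj.1 h2, rfl⟩
      · rw [colInsert_append S hx, colInsert_replace T hl' hu', List.cons.injEq] at h
        have := congrArg List.length h.1
        simp at this h0
        omega
      · rw [colInsert_replace S hl hu, colInsert_append T hy, List.cons.injEq] at h
        have := congrArg List.length h.1
        simp at this h0
        omega
      · rw [colInsert_replace S hl hu, colInsert_replace T hl' hu', List.cons.injEq] at h
        obtain ⟨rfl, rfl⟩ := ih hS' hT' h.2 fun j => by simpa using hlen (j + 1)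
        obtain ⟨rfl, rfl, rfl⟩ := append_cons_inj h.1 hu hu' hl hl'
          (List.pairwise_cons.1 (List.pairwise_append.1 hc).2.1).1
          (List.pairwise_cons.1 (List.pairwise_append.1 hd).2.1).1
        exact ⟨rfl, rfl⟩

/-! ### Adding a box -/

lemma AddBox.perm {x : α} {S T : Tableau α} (h : AddBox x S T) :
    T.flatten.Perm (x :: S.flatten) := by
  induction h with
  | new => simp
  | here c S => simp
  | there c _ ih => simpa using (List.Perm.append_left c ih).trans List.perm_middle

lemma AddBox.colLen {x : α} {S T : Tableau α} (h : AddBox x S T) :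
    ∃ k, ∀ j, colLen T j = colLen S j + if j = k then 1 else 0 := by
  induction h with
  | new => exact ⟨0, fun j => by cases j <;> simp⟩
  | here c S => exact ⟨0, fun j => by cases j <;> simp⟩
  | there c _ ih =>
    obtain ⟨k, hk⟩ := ih
    exact ⟨k + 1, fun j => by cases j <;> simp [hk]⟩

lemma AddBox.headD {x : α} {S T : Tableau α} (h : AddBox x S T) :
    T.headD [] = S.headD [] ∨ T.headD [] = S.headD [] ++ [x] := by
  cases h <;> simp

/-- The new entry is the largest, so it cannot violate an inequality from the left or from above;
only the shape matters. -/
lemma AddBox.isStandard {x : α} {S T : Tableau α} (h : AddBox x S T) (hS : IsStandard S)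
    (hx : ∀ a ∈ S.flatten, a < x) (hlen : ∀ j, Tableau.colLen T (j + 1) ≤ Tableau.colLen T j) :
    IsStandard T := by
  induction h with
  | new => simp [isStandard_cons, rowLt_nil, isStandard_nil]
  | here c S =>
    obtain ⟨h1, h2, h3, h4⟩ := isStandard_cons.1 hS
    refine isStandard_cons.2 ⟨by simp, ?_, h3.append _, h4⟩
    rw [List.pairwise_append]
    exact ⟨h2, by simp, by simpa using fun a ha => hx a (by simp [ha])⟩
  | @there c S T hST ih =>
    obtain ⟨h1, h2, h3, h4⟩ := isStandard_cons.1 hS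
    refine isStandard_cons.2 ⟨h1, h2, ⟨?_, fun i a b ha hb => ?_⟩,
      ih h4 (fun a ha => hx a (by simp only [List.flatten_cons, List.mem_append]; exact Or.inr ha))
        fun j => by simpa using hlen (j + 1)⟩
    · simpa [colLen_zero] using hlen 0
    · have hax : a < x := hx a (by simp [List.mem_of_getElem? ha])
      rcases hST.headD with he | he
      · rw [he] at hb
        exact h3.2 i a b ha hb
      · rw [he] at hb
        rcases lt_or_ge i (S.headD []).length with hi | hi
        · rw [List.getElem?_append_left hi] at hb
          exact h3.2 i a b ha hb
        · rw [List.getElem?_append_right hi] at hb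
          have := List.mem_of_getElem? hb
          simp only [List.mem_singleton] at this
          rwa [this]

lemma exists_addBox (x : α) (S : Tableau α) (k : ℕ)
    (h : ∀ j, (colLen S (j + 1) + if j + 1 = k then 1 else 0) ≤
      colLen S j + if j = k then 1 else 0) :
    ∃ T, AddBox x S T ∧ ∀ j, colLen T j = colLen S j + if j = k then 1 else 0 := by
  induction S generalizing k with
  | nil =>
    cases k with
    | zero => exact ⟨_, .new, fun j => by cases j <;> simp⟩
    | succ k => simpa using h k
  | cons c S ih =>
    cases k with
    | zero => exact ⟨_, .here c S, fun j => by cases j <;> simp⟩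
    | succ k =>
      obtain ⟨T, hT, hlen⟩ := ih k fun j => by simpa using h (j + 1)
      exact ⟨_, .there c hT, fun j => by cases j <;> simp [hlen]⟩

lemma AddBox.unique {x : α} {S T T' : Tableau α} (h : AddBox x S T) (h' : AddBox x S T')
    (hlen : ∀ j, Tableau.colLen T j = Tableau.colLen T' j) : T = T' := by
  induction h generalizing T' with
  | new => cases h'; rfl
  | here c S =>
    cases h' with
    | here => rfl
    | there _ h' => simpa using hlen 0
  | there c _ ih =>
    cases h' with
    | here => simpa using hlen 0
    | there _ h' => rw [ih h' fun j => by simpa using hlen (j + 1)]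

/-- The diagram before a box was added is recovered by erasing the new entry. -/
lemma AddBox.eq_erase {x : α} {S T : Tableau α} (h : AddBox x S T) (hS : IsStandard S)
    (hx : x ∉ S.flatten) :
    S = (T.map fun c => c.filter (· ≠ x)).filter (· ≠ []) := by
  have hfix : ∀ S : Tableau α, IsStandard S → x ∉ S.flatten →
      S = (S.map fun c => c.filter (· ≠ x)).filter (· ≠ []) := by
    intro S hS hx
    induction S with
    | nil => rfl
    | cons c S ih =>
      simp only [List.flatten_cons, List.mem_append, not_or] at hx
      obtain ⟨h1, -, -, h4⟩ := isStandard_cons.1 hS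
      have hc : c.filter (· ≠ x) = c := List.filter_eq_self.2 fun a ha => by
        simpa using fun h : a = x => hx.1 (h ▸ ha)
      rw [List.map_cons, hc, List.filter_cons, if_pos (by simpa using h1), ← ih h4 hx.2]
  induction h with
  | new => simp
  | here c S =>
    have hc : (c ++ [x]).filter (· ≠ x) = c.filter (· ≠ x) := by simp
    rw [List.map_cons, hc]
    exact hfix _ hS hx
  | there c _ ih =>
    simp only [List.flatten_cons, List.mem_append, not_or] at hx
    obtain ⟨h1, -, -, h4⟩ := isStandard_cons.1 hS
    have hc : c.filter (· ≠ x) = c := List.filter_eq_self.2 fun a ha => by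
      simpa using fun h : a = x => hx.1 (h ▸ ha)
    rw [List.map_cons, hc, List.filter_cons, if_pos (by simpa using h1), ← ih h4 hx.2]

/-- Nothing can stand below a maximal entry or to its right, so it occupies a corner. -/
lemma IsStandard.exists_addBox_eq {T : Tableau α} (hT : IsStandard T) {x : α}
    (hx : x ∈ T.flatten) (hmax : ∀ a ∈ T.flatten, a ≤ x) :
    ∃ S, IsStandard S ∧ AddBox x S T := by
  induction T with
  | nil => simp at hx
  | cons c T ih =>
    obtain ⟨h1, h2, h3, h4⟩ := isStandard_cons.1 hT
    simp only [List.flatten_cons, List.mem_append] at hx hmax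
    by_cases hc : x ∈ c
    · obtain ⟨l, r, rfl⟩ := List.append_of_mem hc
      obtain rfl : r = [] := by
        refine List.eq_nil_iff_forall_not_mem.2 fun a ha => ?_
        exact absurd ((List.pairwise_cons.1 (List.pairwise_append.1 h2).2.1).1 a ha)
          (hmax a (by simp [ha])).not_gt
      have hhead : (T.headD []).length ≤ l.length := by
        by_contra! hlt
        have := h3.2 l.length x _ (by simp) (List.getElem?_eq_getElem hlt)
        exact absurd this
          (hmax _ (Or.inr (mem_flatten_of_mem_headD (List.getElem_mem hlt)))).not_gt
      by_cases hl : l = []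
      · subst hl
        have : T = [] := by
          cases T with
          | nil => rfl
          | cons d T => exact absurd (by simpa using hhead) (isStandard_cons.1 h4).1
        subst this
        exact ⟨[], isStandard_nil, .new⟩
      · refine ⟨l :: T, isStandard_cons.2 ⟨hl, (List.pairwise_append.1 h2).1, ⟨hhead, ?_⟩, h4⟩,
          .here l T⟩
        intro i a b ha hb
        refine h3.2 i a b ?_ hb
        rw [List.getElem?_append_left (List.getElem?_eq_some_iff.1 ha).1, ha]
    · obtain ⟨S, hS, hST⟩ := ih h4 (hx.resolve_left hc) fun a ha => hmax a (Or.inr ha)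
      refine ⟨c :: S, isStandard_cons.2 ⟨h1, h2, ?_, hS⟩, .there c hST⟩
      rcases hST.headD with he | he
      · rwa [he] at h3
      · rw [he] at h3
        refine ⟨(by simp : (S.headD []).length ≤ (S.headD [] ++ [x]).length).trans h3.1,
          fun i a b ha hb => h3.2 i a b ha ?_⟩
        rw [List.getElem?_append_left (List.getElem?_eq_some_iff.1 hb).1, hb]

/-! ### Rows, columns and the size -/

lemma IsStandard.lt_colLen_iff {T : Tableau α} (hT : IsStandard T) (i j : ℕ) :
    i < colLen T j ↔ j < rowLen T i := by
  have hanti : ∀ T : Tableau α, IsStandard T → Antitone (colLen T) := fun T hT =>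
    antitone_nat_of_succ_le hT.colLen_succ_le
  induction T generalizing j with
  | nil => simp [rowLen]
  | cons c T ih =>
    have h4 := (isStandard_cons.1 hT).2.2.2
    have hcons : rowLen (c :: T) i = rowLen T i + if i < c.length then 1 else 0 := by
      simp [rowLen, List.countP_cons]
    rw [hcons]
    split_ifs with hc
    · cases j with
      | zero => simp [hc]
      | succ j => simpa using ih h4 j
    · have h0 : ∀ j, ¬ j < rowLen T i := fun j hj => by
        have h1 := (ih h4 j).2 hj
        have h2 := hanti _ hT (Nat.zero_le (j + 1))
        simp at h2
        omega
      have h2 := hanti _ hT (Nat.zero_le j)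
      simp only [colLen_cons_zero] at h2
      have := h0 j
      constructor <;> intro <;> omega

lemma IsStandard.length_le {T : Tableau α} (hT : IsStandard T) : T.length ≤ T.flatten.length := by
  induction T with
  | nil => simp
  | cons c T ih =>
    obtain ⟨h1, -, -, h4⟩ := isStandard_cons.1 hT
    have := List.length_pos_iff.2 h1
    have := ih h4
    simp only [List.flatten_cons, List.length_append, List.length_cons]
    omega

lemma colLen_eq_zero_of_length_le {T : Tableau α} {j : ℕ} (h : T.length ≤ j) :
    colLen T j = 0 := by
  simp [colLen, List.getD_eq_getElem?_getD, List.getElem?_eq_none h]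

end Tableau

open Tableau

/-! ### Sequences of shapes -/

/-- The sequences of column lengths (or row lengths) of oscillating tableaux: they start and end
with the empty diagram, and one box is added or removed in each step. -/
def IsShapeWalk {n : ℕ} (f : Fin (n + 1) → ℕ → ℕ) : Prop :=
  (∀ j, f 0 j = 0) ∧ (∀ j, f (Fin.last n) j = 0) ∧ (∀ t, Antitone (f t)) ∧
    ∀ t : Fin n, ∃ k, (∀ j, f t.succ j = f t.castSucc j + if j = k then 1 else 0) ∨
      (∀ j, f t.castSucc j = f t.succ j + if j = k then 1 else 0)

/-- Stepwise construction of a sequence, forwards. -/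
lemma exists_seq_forward {n : ℕ} {β : Type*} (I : Fin (n + 1) → β → Prop)
    (R : Fin n → β → β → Prop) (b : β) (hb : I 0 b)
    (h : ∀ t S, I t.castSucc S → ∃ S', I t.succ S' ∧ R t S S') :
    ∃ T : Fin (n + 1) → β, T 0 = b ∧ (∀ t, I t (T t)) ∧ ∀ t, R t (T t.castSucc) (T t.succ) := by
  choose! g hg using h
  let T : ∀ t : Fin (n + 1), {S // I t S} := fun t =>
    Fin.induction (motive := fun t => {S // I t S}) ⟨b, hb⟩
      (fun t S => ⟨g t S.1, (hg t S.1 S.2).1⟩) t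
  exact ⟨fun t => (T t).1, rfl, fun t => (T t).2, fun t => (hg t _ (T t.castSucc).2).2⟩

/-- Stepwise construction of a sequence, backwards. -/
lemma exists_seq_backward {n : ℕ} {β : Type*} (I : Fin (n + 1) → β → Prop)
    (R : Fin n → β → β → Prop) (b : β) (hb : I (Fin.last n) b)
    (h : ∀ t S', I t.succ S' → ∃ S, I t.castSucc S ∧ R t S S') :
    ∃ T : Fin (n + 1) → β,
      T (Fin.last n) = b ∧ (∀ t, I t (T t)) ∧ ∀ t, R t (T t.castSucc) (T t.succ) := by
  choose! g hg using h
  let T : ∀ t : Fin (n + 1), {S // I t S} := fun t =>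
    Fin.reverseInduction (motive := fun t => {S // I t S}) ⟨b, hb⟩
      (fun t S => ⟨g t S.1, (hg t S.1 S.2).1⟩) t
  refine ⟨fun t => (T t).1, ?_, fun t => (T t).2, fun t => ?_⟩
  · simp [T]
  · have : (T t.castSucc).1 = g t (T t.succ).1 := by simp [T]
    simp only [this]
    exact (hg t _ (T t.succ).2).2

/-! ### Runs, shapes and involutions -/

section Run

variable {n : ℕ} {T : Fin (n + 1) → Tableau (Fin n)} {σ : Equiv.Perm (Fin n)}

lemma IsSundaramRun.ne (h : IsSundaramRun T σ) (t : Fin n) : σ t ≠ t := by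
  rcases h.2.2.2.2 t with h | h
  · exact h.1.ne'
  · exact h.1.ne

lemma IsSundaramRun.isFixedPointFreeInvolution (h : IsSundaramRun T σ) :
    IsFixedPointFreeInvolution σ := fun i => ⟨h.ne i, h.2.2.2.1 i⟩

lemma IsSundaramRun.entry_lt (h : IsSundaramRun T σ) (t : Fin (n + 1)) :
    ∀ x ∈ (T t).flatten, x.val < t.val := by
  induction t using Fin.induction with
  | zero => simp [h.1]
  | succ t ih =>
    intro x hx
    rcases h.2.2.2.2 t with ⟨-, ha⟩ | ⟨-, he⟩
    · rcases List.mem_cons.1 (ha.perm.mem_iff.1 hx) with rfl | hx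
      · simp
      · have := ih x hx
        simp at this ⊢
        omega
    · have := ih x (by rw [he, (colInsert_perm _ _).mem_iff]; simp [hx])
      simp at this ⊢
      omega

lemma IsSundaramRun.nodup (h : IsSundaramRun T σ) (t : Fin (n + 1)) : (T t).flatten.Nodup := by
  induction t using Fin.induction with
  | zero => simp [h.1]
  | succ t ih =>
    rcases h.2.2.2.2 t with ⟨-, ha⟩ | ⟨-, he⟩
    · rw [ha.perm.nodup_iff, List.nodup_cons]
      exact ⟨fun hx => absurd (h.entry_lt _ _ hx) (by simp), ih⟩
    · rw [he, (colInsert_perm _ _).nodup_iff, List.nodup_cons] at ih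
      exact ih.2

lemma IsSundaramRun.colLen_isShapeWalk (h : IsSundaramRun T σ) :
    IsShapeWalk fun t j => (T t).colLen j := by
  refine ⟨by simp [h.1], by simp [h.2.1],
    fun t => antitone_nat_of_succ_le (h.2.2.1 t).colLen_succ_le, fun t => ?_⟩
  rcases h.2.2.2.2 t with ⟨-, ha⟩ | ⟨-, he⟩
  · obtain ⟨k, hk⟩ := ha.colLen
    exact ⟨k, Or.inl hk⟩
  · obtain ⟨k, hk⟩ := colLen_colInsert (σ t) (T t.succ)
    exact ⟨k, Or.inr fun j => by simp only [he, hk]⟩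

lemma IsSundaramRun.length_step (h : IsSundaramRun T σ) (t : Fin n) :
    (T t.succ).flatten.length = (T t.castSucc).flatten.length + 1 ∨
      (T t.castSucc).flatten.length = (T t.succ).flatten.length + 1 := by
  rcases h.2.2.2.2 t with ⟨-, ha⟩ | ⟨-, he⟩
  · exact Or.inl (by simpa using ha.perm.length_eq)
  · exact Or.inr (by simpa [← he] using (colInsert_perm (σ t) (T t.succ)).length_eq)

/-- The number of boxes is at most the time elapsed and at most the time remaining, and every column
has a box. This is why `N` walkers suffice in the second class. -/
lemma IsSundaramRun.two_mul_length_le (h : IsSundaramRun T σ) (t : Fin (n + 1)) :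
    2 * (T t).length ≤ n := by
  have h1 : (T t).flatten.length ≤ t := by
    induction t using Fin.induction with
    | zero => simp [h.1]
    | succ t ih =>
      rcases h.length_step t with h | h <;> simp only [Fin.val_succ, Fin.val_castSucc] at * <;> omega
  have h2 : (T t).flatten.length + t ≤ n := by
    clear h1
    induction t using Fin.reverseInduction with
    | last => simp [h.2.1]
    | cast t ih =>
      rcases h.length_step t with h | h <;> simp only [Fin.val_succ, Fin.val_castSucc] at * <;> omega
  have := (h.2.2.1 t).length_le
  omega

/-- The involution determines the tableaux. -/
lemma IsSundaramRun.unique_tableau {T' : Fin (n + 1) → Tableau (Fin n)} (h : IsSundaramRun T σ)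
    (h' : IsSundaramRun T' σ) : T = T' := by
  funext t
  -- Backwards in time, each step is a function of the later diagram and `σ`: erase `t` or insert `σ
  -- t`.
  induction t using Fin.reverseInduction with
  | last => rw [h.2.1, h'.2.1]
  | cast t ih =>
    rcases h.2.2.2.2 t with ⟨hl, ha⟩ | ⟨hl, he⟩ <;>
    rcases h'.2.2.2.2 t with ⟨hl', ha'⟩ | ⟨hl', he'⟩
    · rw [ha.eq_erase (h.2.2.1 _) fun hx => absurd (h.entry_lt _ _ hx) (by simp),
        ha'.eq_erase (h'.2.2.1 _) fun hx => absurd (h'.entry_lt _ _ hx) (by simp), ih]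
    · exact absurd hl hl'.not_gt
    · exact absurd hl hl'.not_gt
    · rw [he, he', ih]

/-- The shapes determine the tableaux and the involution. -/
lemma IsSundaramRun.unique_perm {T' : Fin (n + 1) → Tableau (Fin n)} {σ' : Equiv.Perm (Fin n)}
    (h : IsSundaramRun T σ) (h' : IsSundaramRun T' σ')
    (hlen : ∀ t j, (T t).colLen j = (T' t).colLen j) : σ = σ' := by
  -- Forwards in time the shapes force each step, but `σ t` becomes visible only when it is ejected,
  -- i.e. when `σ t < t`.
  have key : ∀ t : Fin n, T t.castSucc = T' t.castSucc →
      T t.succ = T' t.succ ∧ (σ t < t → σ' t = σ t) := by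
    intro t ih
    rcases h.2.2.2.2 t with ⟨hl, ha⟩ | ⟨hl, he⟩ <;>
    rcases h'.2.2.2.2 t with ⟨hl', ha'⟩ | ⟨hl', he'⟩
    · exact ⟨ha.unique (ih ▸ ha') (hlen _), fun hlt => absurd hl hlt.not_gt⟩
    · exfalso
      obtain ⟨k, hk⟩ := ha.colLen
      obtain ⟨k', hk'⟩ := colLen_colInsert (σ' t) (T' t.succ)
      have h1 := hk k
      have h2 := hk' k
      rw [← he', ← hlen, ← hlen] at h2
      rw [if_pos rfl] at h1
      split_ifs at h2 <;> omega
    · exfalso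
      obtain ⟨k, hk⟩ := ha'.colLen
      obtain ⟨k', hk'⟩ := colLen_colInsert (σ t) (T t.succ)
      have h1 := hk k
      have h2 := hk' k
      rw [← he] at h2
      rw [if_pos rfl, ← hlen, ← hlen] at h1
      split_ifs at h2 <;> omega
    · rw [he, he'] at ih
      obtain ⟨h1, h2⟩ := colInsert_inj (h.2.2.1 _) (h'.2.2.1 _) ih (hlen _)
      exact ⟨h2, fun _ => h1.symm⟩
  have hT : ∀ t, T t = T' t := by
    intro t
    induction t using Fin.induction with
    | zero => rw [h.1, h'.1]
    | succ t ih => exact (key t ih).1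
  ext1 t
  rcases lt_or_gt_of_ne (h.ne t) with hl | hl
  · exact ((key t (hT _)).2 hl).symm
  -- For an added entry `t`, the partner is read off at the later step `σ t`, which ejects `t`.
  · have h1 := (key (σ t) (hT _)).2 (by rwa [h.2.2.2.1])
    rw [h.2.2.2.1] at h1
    rw [← h'.2.2.2.1 (σ t), h1]

/-- Every fixed point free involution comes from a sequence of tableaux. -/
lemma exists_isSundaramRun (hσ : IsFixedPointFreeInvolution σ) :
    ∃ T : Fin (n + 1) → Tableau (Fin n), IsSundaramRun T σ := by
  -- Invariant: the entries at time `t` are the two-cycles open at that time, `x < t ≤ σ x`, each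
  -- represented by its smaller element.
  have hback : ∀ (t : Fin n) (S : Tableau (Fin n)),
      (S.IsStandard ∧ S.flatten.Nodup ∧
        ∀ x, x ∈ S.flatten ↔ x.val < t.succ.val ∧ t.succ.val ≤ (σ x).val) →
      ∃ S' : Tableau (Fin n), (S'.IsStandard ∧ S'.flatten.Nodup ∧
        ∀ x, x ∈ S'.flatten ↔ x.val < t.castSucc.val ∧ t.castSucc.val ≤ (σ x).val) ∧
        ((t < σ t ∧ AddBox t S' S) ∨ (σ t < t ∧ S' = Tableau.colInsert (σ t) S)) := by
    rintro t S ⟨hS, hn, hmem⟩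
    simp only [Fin.val_succ, Fin.val_castSucc] at hmem ⊢
    rcases lt_or_gt_of_ne (hσ t).1 with hl | hl
    · have hx : σ t ∉ S.flatten := by
        rw [hmem, (hσ t).2]
        omega
      have hn' := List.nodup_cons.2 ⟨hx, hn⟩
      refine ⟨Tableau.colInsert (σ t) S, ⟨hS.colInsert hn', (colInsert_perm _ _).nodup_iff.2 hn', ?_⟩,
        Or.inr ⟨hl, rfl⟩⟩
      intro x
      rw [(colInsert_perm _ _).mem_iff, List.mem_cons, hmem]
      by_cases hxt : x = σ t
      · subst hxt
        simpa [(hσ t).2] using hl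
      · have h1 : (σ x).val ≠ t.val := fun he => hxt (by rw [← Fin.ext he, (hσ x).2])
        have h2 : x.val = t.val → (σ x).val < t.val := fun he => by
          rw [Fin.ext he]; exact hl
        simp only [hxt, false_or]
        omega
    · have hx : t ∈ S.flatten := (hmem t).2 ⟨by simp, hl⟩
      obtain ⟨S', hS', hadd⟩ := hS.exists_addBox_eq hx fun a ha =>
        Fin.le_def.2 (by have := ((hmem a).1 ha).1; omega)
      have hn' := hadd.perm.nodup_iff.1 hn
      refine ⟨S', ⟨hS', (List.nodup_cons.1 hn').2, ?_⟩, Or.inl ⟨hl, hadd⟩⟩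
      intro x
      by_cases hxt : x = t
      · subst hxt
        simpa using (List.nodup_cons.1 hn').1
      · have h1 := hmem x
        rw [hadd.perm.mem_iff, List.mem_cons] at h1
        simp only [hxt, false_or] at h1
        rw [h1]
        have h2 : x.val ≠ t.val := fun he => hxt (Fin.ext he)
        have h3 : (σ x).val = t.val → t.val < x.val := fun he => by
          have : x = σ t := by rw [← Fin.ext he, (hσ x).2]
          rw [this]; exact hl
        omega
  obtain ⟨T, h1, h2, h3⟩ := exists_seq_backward
    (fun (t : Fin (n + 1)) (S : Tableau (Fin n)) => S.IsStandard ∧ S.flatten.Nodup ∧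
      ∀ x, x ∈ S.flatten ↔ x.val < t.val ∧ t.val ≤ (σ x).val)
    (fun t S S' => (t < σ t ∧ AddBox t S S') ∨ (σ t < t ∧ S = Tableau.colInsert (σ t) S'))
    [] ⟨isStandard_nil, by simp, fun x => by simp⟩ hback
  · refine ⟨T, ?_, h1, fun t => (h2 t).1, fun i => (hσ i).2, h3⟩
    refine (h2 0).1.eq_nil (List.eq_nil_iff_forall_not_mem.2 fun x hx => ?_)
    simpa using (((h2 0).2.2 x).1 hx).1

/-- A symmetric relation in which every element has exactly one partner is an involution. -/
lemma exists_involution {β : Type*} (Q : β → β → Prop) (hQ : ∀ a b, Q a b → Q b a)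
    (hex : ∀ a, ∃ b, Q a b) (huniq : ∀ a b b', Q a b → Q a b' → b = b') :
    ∃ σ : Equiv.Perm β, (∀ a, σ (σ a) = a) ∧ ∀ a, Q a (σ a) := by
  choose g hg using hex
  have hgg : Function.Involutive g := fun a => huniq _ _ _ (hg (g a)) (hQ _ _ (hg a))
  exact ⟨hgg.toPerm g, hgg, hg⟩

/-- Every sequence of shapes comes from a sequence of tableaux. -/
lemma IsShapeWalk.exists_isSundaramRun {f : Fin (n + 1) → ℕ → ℕ} (hf : IsShapeWalk f) :
    ∃ (T : Fin (n + 1) → Tableau (Fin n)) (σ : Equiv.Perm (Fin n)),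
      (∀ t j, (T t).colLen j = f t j) ∧ IsSundaramRun T σ := by
  obtain ⟨hf0, hfn, hanti, hstep⟩ := hf
  -- Only the shapes are known here; the ejected entries are whatever reverse insertion produces,
  -- and `σ` is assembled from them afterwards.
  have hforw : ∀ (t : Fin n) (S : Tableau (Fin n)),
      (S.IsStandard ∧ S.flatten.Nodup ∧ (∀ x ∈ S.flatten, x.val < t.castSucc.val) ∧
        ∀ j, S.colLen j = f t.castSucc j) →
      ∃ S' : Tableau (Fin n), (S'.IsStandard ∧ S'.flatten.Nodup ∧
        (∀ x ∈ S'.flatten, x.val < t.succ.val) ∧ ∀ j, S'.colLen j = f t.succ j) ∧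
        (AddBox t S S' ∨ ∃ x, S = Tableau.colInsert x S') := by
    rintro t S ⟨hS, hn, hlt, hlen⟩
    simp only [Fin.val_castSucc, Fin.val_succ] at hlt ⊢
    obtain ⟨k, hk | hk⟩ := hstep t
    · obtain ⟨S', hadd, hlen'⟩ := exists_addBox t S k fun j => by
        rw [hlen, hlen, ← hk, ← hk]
        exact hanti _ (Nat.le_succ j)
      have hlen'' : ∀ j, S'.colLen j = f t.succ j := fun j => by rw [hlen', hlen, hk]
      refine ⟨S', ⟨hadd.isStandard hS (fun a ha => Fin.lt_def.2 (hlt a ha)) fun j => ?_, ?_, ?_,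
        hlen''⟩, Or.inl hadd⟩
      · rw [hlen'', hlen'']
        exact hanti _ (Nat.le_succ j)
      · rw [hadd.perm.nodup_iff, List.nodup_cons]
        exact ⟨fun hx => absurd (hlt _ hx) (lt_irrefl _), hn⟩
      · intro x hx
        rcases List.mem_cons.1 (hadd.perm.mem_iff.1 hx) with rfl | hx
        · omega
        · have := hlt x hx
          omega
    · obtain ⟨x, S', hS', hins, hlen'⟩ := hS.exists_colInsert_eq hn (k := k) (by
        have h1 := hanti t.succ (Nat.le_add_right k 1)
        have h2 := hk k
        have h3 := hk (k + 1)
        rw [if_pos rfl] at h2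
        rw [if_neg (by omega)] at h3
        rw [hlen, hlen]
        omega)
      have hp := colInsert_perm x S'
      rw [hins] at hp
      refine ⟨S', ⟨hS', (List.nodup_cons.1 (hp.nodup_iff.1 hn)).2, fun y hy => ?_, fun j => ?_⟩,
        Or.inr ⟨x, hins.symm⟩⟩
      · have := hlt y (hp.mem_iff.2 (List.mem_cons_of_mem _ hy))
        omega
      · have h1 := hlen' j
        rw [hlen, hk] at h1
        omega
  obtain ⟨T, h1, h2, h3⟩ := exists_seq_forward
    (fun (t : Fin (n + 1)) (S : Tableau (Fin n)) => S.IsStandard ∧ S.flatten.Nodup ∧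
      (∀ x ∈ S.flatten, x.val < t.val) ∧ ∀ j, S.colLen j = f t j)
    (fun t S S' => AddBox t S S' ∨ ∃ x, S = Tableau.colInsert x S')
    [] ⟨isStandard_nil, by simp, by simp, fun j => by simp [hf0]⟩ hforw
  · have hlast : T (Fin.last n) = [] := by
      have hS := (h2 (Fin.last n)).1
      have h0 := (h2 (Fin.last n)).2.2.2 0
      rw [hfn] at h0
      generalize T (Fin.last n) = S at hS h0
      cases S with
      | nil => rfl
      | cons c S =>
        rw [colLen_cons_zero, List.length_eq_zero_iff] at h0
        exact absurd h0 (isStandard_cons.1 hS).1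
    have hnot : ∀ (t x : Fin n), AddBox t (T t.castSucc) (T t.succ) →
        T t.castSucc ≠ Tableau.colInsert x (T t.succ) := by
      intro t x ha he
      have e1 := ha.perm.length_eq
      have e2 := (colInsert_perm x (T t.succ)).length_eq
      rw [← he] at e2
      simp only [List.length_cons] at e1 e2
      omega
    have heject : ∀ (t x : Fin n), T t.castSucc = Tableau.colInsert x (T t.succ) →
        x ∉ (T t.succ).flatten ∧ ∀ y, y ∈ (T t.castSucc).flatten ↔ y = x ∨ y ∈ (T t.succ).flatten := by
      intro t x he
      have hp := colInsert_perm x (T t.succ)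
      rw [← he] at hp
      exact ⟨(List.nodup_cons.1 (hp.nodup_iff.1 (h2 t.castSucc).2.1)).1,
        fun y => by rw [hp.mem_iff, List.mem_cons]⟩
    -- An entry is present exactly when it has been written and not yet ejected.
    have hmem : ∀ (t : Fin (n + 1)) (x : Fin n), x ∈ (T t).flatten ↔ x.val < t.val ∧ AddBox x (T x.castSucc) (T x.succ) ∧
        ∀ s : Fin n, s.val < t.val → T s.castSucc ≠ Tableau.colInsert x (T s.succ) := by
      intro t
      induction t using Fin.induction with
      | zero => simp [h1]
      | succ t ih =>
        intro x
        have ih' := ih x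
        simp only [Fin.val_castSucc, Fin.val_succ] at ih' ⊢
        have hsplit : (∀ s : Fin n, s.val < t.val + 1 →
              T s.castSucc ≠ Tableau.colInsert x (T s.succ)) ↔
            (∀ s : Fin n, s.val < t.val → T s.castSucc ≠ Tableau.colInsert x (T s.succ)) ∧
              T t.castSucc ≠ Tableau.colInsert x (T t.succ) := by
          refine ⟨fun h => ⟨fun s hs => h s (by omega), h t (by omega)⟩, fun h s hs => ?_⟩
          rcases Nat.lt_succ_iff_lt_or_eq.1 hs with hs | hs
          · exact h.1 s hs
          · rw [Fin.ext hs]; exact h.2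
        rw [hsplit]
        rcases h3 t with ha | ⟨u, hu⟩
        · rw [ha.perm.mem_iff, List.mem_cons]
          by_cases hxt : x = t
          · subst hxt
            simp only [true_or, lt_add_iff_pos_right, zero_lt_one, ha, true_and, true_iff]
            refine ⟨fun s hs he => ?_, hnot x x ha⟩
            have := (h2 s.castSucc).2.2.1 x (((heject s x he).2 x).2 (Or.inl rfl))
            simp at this
            omega
          · have hne : x.val ≠ t.val := fun he => hxt (Fin.ext he)
            simp only [hxt, false_or, ih', hnot t x ha, ne_eq, not_false_eq_true, and_true]
            exact and_congr_left fun _ => by omega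
        · obtain ⟨hu1, hu2⟩ := heject t u hu
          have hux : T t.castSucc = Tableau.colInsert x (T t.succ) ↔ x = u := by
            refine ⟨fun he => ?_, fun he => he ▸ hu⟩
            obtain ⟨hx1, hx2⟩ := heject t x he
            exact ((hu2 x).1 ((hx2 x).2 (Or.inl rfl))).resolve_right hx1
          have hx : x ∈ (T t.succ).flatten ↔ x ∈ (T t.castSucc).flatten ∧ x ≠ u := by
            rw [hu2]
            constructor
            · exact fun hx => ⟨Or.inr hx, fun he => hu1 (he ▸ hx)⟩
            · exact fun hx => hx.1.resolve_left hx.2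
          rw [hx, ih', show T t.castSucc ≠ Tableau.colInsert x (T t.succ) ↔ x ≠ u from not_congr hux]
          by_cases hxt : x = t
          · subst hxt
            have : ¬ AddBox x (T x.castSucc) (T x.succ) := fun ha => hnot x u ha hu
            simp [this]
          · have hne : x.val ≠ t.val := fun he => hxt (Fin.ext he)
            have : x.val < t.val + 1 ↔ x.val < t.val := by omega
            rw [this]
            tauto
    have hfact : ∀ s x : Fin n, T s.castSucc = Tableau.colInsert x (T s.succ) → x < s ∧
        AddBox x (T x.castSucc) (T x.succ) ∧
        ∀ r < s, T r.castSucc ≠ Tableau.colInsert x (T r.succ) := fun s x he => by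
      simpa using (hmem s.castSucc x).1 (((heject s x he).2 x).2 (Or.inl rfl))
    -- A written entry must be ejected at some time because the final diagram is empty.
    have hex : ∀ t : Fin n, ∃ x : Fin n, (T t.castSucc = Tableau.colInsert x (T t.succ) ∨
        T x.castSucc = Tableau.colInsert t (T x.succ)) := by
      intro t
      rcases h3 t with ha | ⟨u, hu⟩
      · by_contra! hno
        have := (hmem (Fin.last n) t).2 ⟨by simp, ha, fun s _ => (hno s).2⟩
        simp [hlast] at this
      · exact ⟨u, Or.inl hu⟩
    -- No entry is ejected twice, since `x` can be written only at step `x`; and no step both writes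
    -- and ejects.
    have huniq : ∀ a b b' : Fin n, (T a.castSucc = Tableau.colInsert b (T a.succ) ∨
        T b.castSucc = Tableau.colInsert a (T b.succ)) →
      (T a.castSucc = Tableau.colInsert b' (T a.succ) ∨
        T b'.castSucc = Tableau.colInsert a (T b'.succ)) → b = b' := by
      rintro a b b' (h | h) (h' | h')
      · exact (((heject a b' h').2 b).1 (((heject a b h).2 b).2 (Or.inl rfl))).resolve_right
          (heject a b h).1
      · exact absurd h (hnot a b (hfact _ _ h').2.1)
      · exact absurd h' (hnot a b' (hfact _ _ h).2.1)
      · rcases lt_trichotomy b b' with hlt | he | hlt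
        · exact absurd h ((hfact _ _ h').2.2 b hlt)
        · exact he
        · exact absurd h' ((hfact _ _ h).2.2 b' hlt)
    obtain ⟨σ, hσ, hQ⟩ := exists_involution
      (fun s x => T s.castSucc = Tableau.colInsert x (T s.succ) ∨
        T x.castSucc = Tableau.colInsert s (T x.succ)) (fun _ _ => Or.symm) hex huniq
    · refine ⟨T, σ, fun t => (h2 t).2.2.2, h1, hlast, fun t => (h2 t).1, hσ, fun t => ?_⟩
      rcases hQ t with h | h
      · exact Or.inr ⟨(hfact _ _ h).1, h⟩
      · exact Or.inl ⟨(hfact _ _ h).1, (hfact _ _ h).2.1⟩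

end Run

/-! ### The first column and nestings -/

/-- The greedy recursion for longest increasing subsequences: the entries below `x` stay and `x`
comes right after them. If the displaced entry is below `v`, the count is unchanged and already
large enough; otherwise it grows by one. -/
lemma countP_colBump {n : ℕ} {c : List (Fin n)} (hc : c.Pairwise (· < ·)) (x : Fin n) (v : ℕ) :
    (colBump x c).1.countP (fun a => a.val < v) =
      if x.val < v then
        max (c.countP fun a => a.val < v) ((c.countP fun a => a.val < x.val) + 1)
      else c.countP fun a => a.val < v := by
  rcases colBump_cases x c with h | ⟨l, y, r, rfl, hy, hl⟩
  · rw [colBump_append h]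
    have h1 : c.countP (fun a => a.val < x.val) = c.length :=
      List.countP_eq_length.2 fun a ha => by simpa using h a ha
    split_ifs with hv
    · have h2 : c.countP (fun a => a.val < v) = c.length :=
        List.countP_eq_length.2 fun a ha => by
          have : a.val < x.val := h a ha
          simp only [decide_eq_true_eq]
          omega
      rw [h1, h2, List.countP_append, h2]
      simp [hv]
    · simp [hv]
  · rw [colBump_replace hl hy]
    have hr := (List.pairwise_cons.1 (List.pairwise_append.1 hc).2.1).1
    have hy' : x.val ≤ y.val := hy
    have h1 : l.countP (fun a => a.val < x.val) = l.length :=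
      List.countP_eq_length.2 fun a ha => by simpa using hl a ha
    have h0 : ∀ w ≤ y.val, r.countP (fun a => a.val < w) = 0 := fun w hw =>
      List.countP_eq_zero.2 fun a ha => by
        have : y.val < a.val := hr a ha
        simp only [decide_eq_true_eq]
        omega
    split_ifs with hv
    · have h2 : l.countP (fun a => a.val < v) = l.length :=
        List.countP_eq_length.2 fun a ha => by
          have : a.val < x.val := hl a ha
          simp only [decide_eq_true_eq]
          omega
      simp only [List.countP_append, List.countP_cons, h1, h2, hv, h0 _ hy', decide_true, if_true,
        decide_eq_true_eq, not_lt.2 hy', if_false]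
      by_cases hyv : y.val < v
      · simp only [hyv, if_true]
        omega
      · simp only [hyv, if_false, h0 v (not_lt.1 hyv)]
        omega
    · have hyv : ¬ y.val < v := by omega
      simp [List.countP_append, hv, hyv]

section Nesting

variable {n : ℕ} {T : Fin (n + 1) → Tableau (Fin n)} {σ : Equiv.Perm (Fin n)}

/-- The number of entries less than `v` in the first column of `T t` is the maximal length of a
decreasing subsequence of `σ` at positions from `t` on with values less than `v`. -/
lemma IsSundaramRun.isGreatest_countP (h : IsSundaramRun T σ) (t : Fin (n + 1)) :
    ∀ v ≤ t.val, IsGreatest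
      {k | ∃ A : Finset (Fin n), StrictAntiOn σ (A : Set (Fin n)) ∧
        (∀ a ∈ A, t.val ≤ a.val ∧ (σ a).val < v) ∧ A.card = k}
      (((T t).headD []).countP fun a => a.val < v) := by
  -- The threshold `v` must vary: a step that inserts `σ t` refers to the count below `σ t`,
  -- matching subsequences that begin at position `t`.
  induction t using Fin.reverseInduction with
  | last =>
    intro v _
    refine ⟨⟨∅, by simp [StrictAntiOn, h.2.1]⟩, ?_⟩
    rintro k ⟨A, -, hA, rfl⟩
    have : A = ∅ := Finset.eq_empty_of_forall_notMem fun a ha => by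
      have := (hA a ha).1
      simp at this
      omega
    simp [this]
  | cast t ih =>
    simp only [Fin.val_succ, Fin.val_castSucc] at ih ⊢
    intro v hv
    rcases h.2.2.2.2 t with ⟨hlt, ha⟩ | ⟨hlt, he⟩
    -- Here `v ≤ t < σ t`: the entry `t` is not counted, and position `t` cannot join a subsequence
    -- with values below `v`.
    · have hcount : ((T t.succ).headD []).countP (fun a => a.val < v) =
          ((T t.castSucc).headD []).countP fun a => a.val < v := by
        rcases ha.headD with hh | hh
        · rw [hh]
        · rw [hh, List.countP_append]
          simp [hv]
      obtain ⟨⟨A, hA1, hA2, hA3⟩, hmax⟩ := ih v (by omega)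
      rw [← hcount]
      refine ⟨⟨A, hA1, fun a ha => ⟨by have := (hA2 a ha).1; omega, (hA2 a ha).2⟩, hA3⟩, ?_⟩
      rintro k ⟨B, hB1, hB2, rfl⟩
      refine hmax ⟨B, hB1, fun a ha => ⟨?_, (hB2 a ha).2⟩, rfl⟩
      refine lt_of_le_of_ne (hB2 a ha).1 fun hta => ?_
      have h1 := (hB2 a ha).2
      rw [← Fin.ext hta] at h1
      have : t.val < (σ t).val := hlt
      omega
    · rw [he, headD_colInsert, countP_colBump (h.2.2.1 _).headD_pairwise]
      have hlt' : (σ t).val < t.val := hlt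
      obtain ⟨⟨A, hA1, hA2, hA3⟩, hmax⟩ := ih v (by omega)
      obtain ⟨⟨B, hB1, hB2, hB3⟩, hmax'⟩ := ih (σ t).val (by omega)
      have hAmem : ∃ A : Finset (Fin n), StrictAntiOn σ (A : Set (Fin n)) ∧
          (∀ a ∈ A, t.val ≤ a.val ∧ (σ a).val < v) ∧
          A.card = ((T t.succ).headD []).countP fun a => a.val < v :=
        ⟨A, hA1, fun a ha => ⟨by have := (hA2 a ha).1; omega, (hA2 a ha).2⟩, hA3⟩
      constructor
      · split_ifs with hxv
        · rcases le_total (((T t.succ).headD []).countP (fun a => a.val < (σ t).val) + 1)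
            (((T t.succ).headD []).countP fun a => a.val < v) with hle | hle
          · rw [max_eq_left hle]
            exact hAmem
          · rw [max_eq_right hle]
            have htB : t ∉ B := fun ht => by have := (hB2 t ht).1; omega
            refine ⟨insert t B, ?_, ?_, by rw [Finset.card_insert_of_notMem htB, hB3]⟩
            · intro a ha b hb hab
              simp only [Finset.coe_insert, Set.mem_insert_iff, Finset.mem_coe] at ha hb
              rcases ha with rfl | ha <;> rcases hb with rfl | hb
              · exact absurd hab (lt_irrefl _)
              · exact (hB2 b hb).2
              · have := (hB2 a ha).1
                have : a.val < b.val := hab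
                omega
              · exact hB1 ha hb hab
            · intro a ha
              rcases Finset.mem_insert.1 ha with rfl | ha
              · exact ⟨le_rfl, hxv⟩
              · have := hB2 a ha
                omega
        · exact hAmem
      · rintro k ⟨C, hC1, hC2, rfl⟩
        by_cases htC : t ∈ C
        · have hxv := (hC2 t htC).2
          rw [if_pos hxv]
          refine le_max_of_le_right ?_
          rw [← Finset.card_erase_add_one htC]
          refine Nat.add_le_add_right (hmax' ⟨C.erase t, hC1.mono (by simp), fun a ha => ?_, rfl⟩) 1
          obtain ⟨hat, haC⟩ := Finset.mem_erase.1 ha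
          have hta : t < a := lt_of_le_of_ne (Fin.le_def.2 (hC2 a haC).1) hat.symm
          exact ⟨hta, hC1 htC haC hta⟩
        · have hle := hmax ⟨C, hC1, fun a ha => ⟨?_, (hC2 a ha).2⟩, rfl⟩
          · split_ifs
            · exact le_max_of_le_left hle
            · exact hle
          · refine lt_of_le_of_ne (hC2 a ha).1 fun hta => htC ?_
            rwa [Fin.ext hta]

/-- At threshold `v = t` the whole first column is counted, as all entries are smaller than `t`. -/
lemma IsSundaramRun.colLen_zero_le_iff_nesting (h : IsSundaramRun T σ) (t : Fin (n + 1)) (p : ℕ) :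
    (T t).colLen 0 ≤ p ↔ ∀ A : Finset (Fin n), StrictAntiOn σ (A : Set (Fin n)) →
      (∀ a ∈ A, t.val ≤ a.val ∧ (σ a).val < t.val) → A.card ≤ p := by
  have hcount : ((T t).headD []).countP (fun a => a.val < t.val) = (T t).colLen 0 := by
    rw [colLen_zero, List.countP_eq_length]
    exact fun a ha => by simpa using h.entry_lt t a (mem_flatten_of_mem_headD ha)
  obtain ⟨⟨A, hA1, hA2, hA3⟩, hmax⟩ := h.isGreatest_countP t t.val le_rfl
  rw [hcount] at hA3 hmax
  constructor
  · exact fun hp B hB1 hB2 => (hmax ⟨B, hB1, hB2, rfl⟩).trans hp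
  · exact fun hp => hA3 ▸ hp A hA1 hA2

lemma maxDecreasingLength_le_iff (k : ℕ) : maxDecreasingLength σ ≤ k ↔
    ∀ B : Finset (Fin n), StrictAntiOn σ (B : Set (Fin n)) → B.card ≤ k := by
  classical
  simp [maxDecreasingLength, Finset.sup_le_iff]

/-- The first columns have length at most `p` if and only if the decreasing subsequences have
length at most `2 * p`. -/
lemma IsSundaramRun.colLen_zero_le_iff (h : IsSundaramRun T σ) (p : ℕ) :
    (∀ t, (T t).colLen 0 ≤ p) ↔ maxDecreasingLength σ ≤ 2 * p := by
  simp only [h.colLen_zero_le_iff_nesting, maxDecreasingLength_le_iff]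
  have hinv := h.2.2.2.1
  constructor
  · intro hp B hB
    -- Cut at the smallest position `m` of `A`: for `a ∈ A` one has `σ a ≤ σ m < m ≤ a`, so all
    -- these two-cycles straddle the same time.
    have hlow : ∀ A : Finset (Fin n), StrictAntiOn σ (A : Set (Fin n)) → (∀ a ∈ A, σ a < a) →
        A.card ≤ p := by
      intro A hA hA'
      rcases A.eq_empty_or_nonempty with rfl | hne
      · simp
      · have hm := A.min'_mem hne
        refine hp (A.min' hne).castSucc A hA fun a ha => ⟨A.min'_le a ha, ?_⟩
        exact lt_of_le_of_lt (hA.antitoneOn hm ha (A.min'_le a ha)) (hA' _ hm)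
    have h1 := hlow (B.filter fun b => σ b < b) (hB.mono (by simp [Set.subset_def]; tauto)) fun a ha =>
      (Finset.mem_filter.1 ha).2
    -- The positions with `b < σ b` are carried by `σ` to ones of the opposite kind, still
    -- decreasing because `σ` is its own inverse.
    have h2 := hlow ((B.filter fun b => ¬ σ b < b).map σ.toEmbedding) ?_ ?_
    · rw [Finset.card_map] at h2
      have := B.card_filter_add_card_filter_not (fun b => σ b < b)
      omega
    · intro a ha b hb hab
      simp only [Finset.coe_map, Set.mem_image, Finset.mem_coe, Finset.mem_filter,
        Equiv.coe_toEmbedding] at ha hb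
      obtain ⟨a, ⟨ha, -⟩, rfl⟩ := ha
      obtain ⟨b, ⟨hb, -⟩, rfl⟩ := hb
      rw [hinv, hinv]
      exact (hB.lt_iff_gt ha hb).1 hab
    · intro a ha
      simp only [Finset.mem_map, Finset.mem_filter, Equiv.coe_toEmbedding] at ha
      obtain ⟨a, ⟨-, ha⟩, rfl⟩ := ha
      rw [hinv]
      exact lt_of_le_of_ne (not_lt.1 ha) (h.ne a).symm
  · intro hp t A hA hA'
    -- `A` lies at or after time `t` and its image before it; together they form a decreasing
    -- subsequence of twice the length.
    have hdisj : Disjoint A (A.map σ.toEmbedding) := by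
      rw [Finset.disjoint_left]
      intro a ha ha'
      simp only [Finset.mem_map, Equiv.coe_toEmbedding] at ha'
      obtain ⟨b, hb, rfl⟩ := ha'
      have := (hA' _ ha).1
      have := (hA' _ hb).2
      omega
    have h1 := hp (A ∪ A.map σ.toEmbedding) ?_
    · rw [Finset.card_union_of_disjoint hdisj, Finset.card_map] at h1
      omega
    · intro a ha b hb hab
      simp only [Finset.coe_union, Finset.coe_map, Set.mem_union, Set.mem_image, Finset.mem_coe,
        Equiv.coe_toEmbedding] at ha hb
      rcases ha with ha | ⟨a, ha, rfl⟩ <;> rcases hb with hb | ⟨b, hb, rfl⟩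
      · exact hA ha hb hab
      · have := (hA' _ ha).1
        have := (hA' _ hb).2
        have : a.val < (σ b).val := hab
        omega
      · rw [hinv]
        exact Fin.lt_def.2 ((hA' _ hb).2.trans_le (hA' _ ha).1)
      · rw [hinv, hinv]
        exact (hA.lt_iff_gt ha hb).1 hab

end Nesting

/-! ### Conjugation of shape sequences -/

lemma IsShapeWalk.exists_eq_zero {n : ℕ} {g : Fin (n + 1) → ℕ → ℕ} (hg : IsShapeWalk g)
    (t : Fin (n + 1)) : ∃ m, ∀ j, m ≤ j → g t j = 0 := by
  induction t using Fin.induction with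
  | zero => exact ⟨0, fun j _ => hg.1 j⟩
  | succ t ih =>
    obtain ⟨m, hm⟩ := ih
    obtain ⟨k, hk | hk⟩ := hg.2.2.2 t
    · refine ⟨max m (k + 1), fun j hj => ?_⟩
      rw [hk, hm j (le_trans (le_max_left _ _) hj), if_neg]
      have := le_trans (le_max_right _ _) hj
      omega
    · refine ⟨m, fun j hj => ?_⟩
      have := hk j
      rw [hm j hj] at this
      omega

/-- The box added at the end of row `k` lies in column `a k`, so that is the column of the conjugate
shape that grows. -/
lemma conj_add_single {a a' b b' : ℕ → ℕ} (ha : Antitone a) (ha' : Antitone a')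
    (hab : ∀ i j, i < b j ↔ j < a i) (hab' : ∀ i j, i < b' j ↔ j < a' i) {k : ℕ}
    (hk : ∀ i, a' i = a i + if i = k then 1 else 0) (j : ℕ) :
    b' j = b j + if j = a k then 1 else 0 := by
  split_ifs with hj
  · subst hj
    have h1 : b' (a k) = k + 1 := eq_of_forall_lt_iff fun i => by
      rw [hab', hk]
      split_ifs with hi
      · subst hi; simp
      · rcases lt_or_gt_of_ne hi with hi | hi
        · have h2 := ha' hi.le
          rw [hk, hk, if_pos rfl, if_neg (by omega)] at h2
          constructor <;> intro <;> omega
        · have h2 := ha hi.le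
          constructor <;> intro <;> omega
    have h2 : b (a k) = k := eq_of_forall_lt_iff fun i => by
      rw [hab]
      rcases lt_or_ge i k with hi | hi
      · have h2 := ha' hi.le
        rw [hk, hk, if_pos rfl, if_neg (by omega)] at h2
        constructor <;> intro <;> omega
      · have h2 := ha hi
        constructor <;> intro <;> omega
    rw [h1, h2]
  · refine eq_of_forall_lt_iff fun i => ?_
    rw [hab', add_zero, hab, hk]
    split_ifs with hi
    · subst hi
      omega
    · simp

/-- Tableaux are built by columns, whereas the first class prescribes rows; conjugation translates
between the two. -/
lemma IsShapeWalk.exists_conj {n : ℕ} {g : Fin (n + 1) → ℕ → ℕ} (hg : IsShapeWalk g) :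
    ∃ f, IsShapeWalk f ∧ ∀ (t : Fin (n + 1)) (i j : ℕ), i < f t j ↔ j < g t i := by
  have hex : ∀ (t : Fin (n + 1)) (j : ℕ), ∃ i, g t i ≤ j := fun t j => by
    obtain ⟨m, hm⟩ := hg.exists_eq_zero t
    exact ⟨m, by simp [hm m le_rfl]⟩
  obtain ⟨f, hf⟩ : ∃ f : Fin (n + 1) → ℕ → ℕ, ∀ t i j, i < f t j ↔ j < g t i := by
    refine ⟨fun t j => Nat.find (hex t j), fun t i j => ?_⟩
    rw [Nat.lt_find_iff]
    exact ⟨fun h => not_le.1 (h i le_rfl), fun h m hm => not_le.2 (h.trans_le (hg.2.2.1 t hm))⟩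
  have hzero : ∀ t, (∀ j, g t j = 0) → ∀ j, f t j = 0 := fun t h j =>
    Nat.eq_zero_of_not_pos fun hp => by simpa [h] using (hf t 0 j).1 hp
  refine ⟨f, ⟨hzero _ hg.1, hzero _ hg.2.1, fun t i j hij => ?_, fun t => ?_⟩, hf⟩
  · refine le_of_forall_lt fun k hk => ?_
    rw [hf] at hk ⊢
    omega
  · obtain ⟨k, hk | hk⟩ := hg.2.2.2 t
    · exact ⟨_, Or.inl (conj_add_single (hg.2.2.1 _) (hg.2.2.1 _) (hf _) (hf _) hk)⟩
    · exact ⟨_, Or.inr (conj_add_single (hg.2.2.1 _) (hg.2.2.1 _) (hf _) (hf _) hk)⟩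

/-! ### Walkers and shape sequences -/

lemma StrictMono.add_sub_le {m : ℕ} {f : Fin m → ℤ} (hf : StrictMono f) {i j : Fin m}
    (hij : i ≤ j) : f i + ((j : ℤ) - i) ≤ f j := by
  have key : ∀ (d : ℕ) (i j : Fin m), j.val = i.val + d → f i + d ≤ f j := by
    intro d
    induction d with
    | zero =>
      intro i j h
      rw [Fin.ext (h.trans (add_zero _))]
      simp
    | succ d ih =>
      intro i j h
      have h1 := ih i ⟨i.val + d, by omega⟩ rfl
      have h2 : f ⟨i.val + d, by omega⟩ < f j := hf (Fin.lt_def.2 (by simp; omega))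
      push_cast
      omega
  have := key (j.val - i.val) i j (by have := Fin.le_def.1 hij; omega)
  have := Fin.le_def.1 hij
  omega

namespace WalkerConfig

variable {m n : ℕ}

lemma disp_of_lt (c : WalkerConfig m n) (t : Fin (n + 1)) (i : Fin m) :
    c.disp t i.rev.val = c.pos t i - (i + 1) := by
  have h : i.rev.val < m := i.rev.isLt
  rw [disp, dif_pos h, Fin.eta, Fin.rev_rev, c.start]

lemma disp_of_le (c : WalkerConfig m n) (t : Fin (n + 1)) {j : ℕ} (h : m ≤ j) :
    c.disp t j = 0 := by
  rw [disp, dif_neg (by omega)]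

lemma exists_eq_rev_val {j : ℕ} (h : j < m) : ∃ i : Fin m, j = i.rev.val :=
  ⟨Fin.rev ⟨j, h⟩, by rw [Fin.rev_rev]⟩

lemma ext_disp {c c' : WalkerConfig m n} (h : ∀ t j, c.disp t j = c'.disp t j) : c = c' := by
  ext t i
  have := h t i.rev.val
  rw [disp_of_lt, disp_of_lt] at this
  omega

/-- The wall matters only for the left-most walker; strict order on integer sites carries the bound
to the others. -/
lemma disp_nonneg (c : WalkerConfig m n) (t : Fin (n + 1)) (j : ℕ) : 0 ≤ c.disp t j := by
  rcases lt_or_ge j m with h | h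
  · obtain ⟨i, rfl⟩ := exists_eq_rev_val h
    have h0 : 0 < m := by omega
    have h1 := (c.vicious t).add_sub_le (i := ⟨0, h0⟩) (j := i) (Fin.le_def.2 (Nat.zero_le _))
    have h2 := c.wall t ⟨0, h0⟩
    rw [disp_of_lt]
    simp at h1
    omega
  · rw [disp_of_le c t h]

lemma disp_antitone (c : WalkerConfig m n) (t : Fin (n + 1)) : Antitone (c.disp t) := by
  intro j k hjk
  rcases lt_or_ge k m with h | h
  · obtain ⟨i, rfl⟩ := exists_eq_rev_val h
    obtain ⟨i', rfl⟩ := exists_eq_rev_val (hjk.trans_lt h)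
    have h1 := (c.vicious t).add_sub_le (i := i) (j := i') (Fin.rev_le_rev.1 hjk)
    rw [disp_of_lt, disp_of_lt]
    omega
  · rw [disp_of_le c t h]
    exact c.disp_nonneg t j

/-- The displacements form a shape sequence. -/
lemma exists_isShapeWalk (c : WalkerConfig m n) :
    ∃ g, IsShapeWalk g ∧ ∀ t j, c.disp t j = (g t j : ℤ) := by
  have hcast : ∀ t j, c.disp t j = ((c.disp t j).toNat : ℤ) := fun t j =>
    (Int.toNat_of_nonneg (c.disp_nonneg t j)).symm
  have hend : ∀ t, (∀ i, c.pos t i = (i : ℤ) + 1) → ∀ j, (c.disp t j).toNat = 0 := by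
    intro t ht j
    rcases lt_or_ge j m with h | h
    · obtain ⟨i, rfl⟩ := exists_eq_rev_val h
      rw [disp_of_lt, ht, sub_self, Int.toNat_zero]
    · simp [disp_of_le c t h]
  have hadd : ∀ (t t' : Fin (n + 1)) (i : Fin m), c.pos t' i = c.pos t i + 1 →
      (∀ k, k ≠ i → c.pos t' k = c.pos t k) →
      ∀ j, (c.disp t' j).toNat = (c.disp t j).toNat + if j = i.rev.val then 1 else 0 := by
    intro t t' i hi hk j
    refine Nat.cast_injective (R := ℤ) ?_
    rw [Nat.cast_add, ← hcast, ← hcast]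
    rcases lt_or_ge j m with h | h
    · obtain ⟨l, rfl⟩ := exists_eq_rev_val h
      rw [disp_of_lt, disp_of_lt]
      by_cases hl : l = i
      · subst hl
        rw [if_pos rfl, hi, Nat.cast_one]
        ring
      · rw [hk l hl, if_neg (fun he => hl (Fin.rev_injective (Fin.ext he))), Nat.cast_zero, add_zero]
    · have := i.rev.isLt
      rw [disp_of_le c t h, disp_of_le c t' h, if_neg (by omega)]
      simp
  refine ⟨fun t j => (c.disp t j).toNat, ⟨hend _ c.start, hend _ c.finish,
    fun t i j hij => Int.toNat_le_toNat (c.disp_antitone t hij), fun t => ?_⟩, hcast⟩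
  obtain ⟨i, hi | hi, hk⟩ := c.step t
  · exact ⟨_, Or.inl (hadd _ _ i hi hk)⟩
  · exact ⟨_, Or.inr (hadd _ _ i (by omega) fun k hki => (hk k hki).symm)⟩

end WalkerConfig

/-- Every shape sequence with at most `m` rows (or columns) is given by displacements. -/
lemma IsShapeWalk.exists_walkerConfig {m n : ℕ} {g : Fin (n + 1) → ℕ → ℕ} (hg : IsShapeWalk g)
    (hm : ∀ t, g t m = 0) : ∃ c : WalkerConfig m n, ∀ t j, c.disp t j = (g t j : ℤ) := by
  have hm' : ∀ t j, m ≤ j → g t j = 0 := fun t j hj =>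
    Nat.eq_zero_of_le_zero ((hg.2.2.1 t hj).trans (hm t).le)
  have hsingle : ∀ (t t' : Fin (n + 1)) (k : ℕ),
      (∀ j, g t' j = g t j + if j = k then 1 else 0) →
      ∃ i : Fin m, g t' i.rev = g t i.rev + 1 ∧ ∀ l, l ≠ i → g t' l.rev = g t l.rev := by
    intro t t' k hk
    have hkm : k < m := by
      by_contra! hle
      have := hk k
      rw [hm' _ k hle, if_pos rfl] at this
      omega
    obtain ⟨i, rfl⟩ := WalkerConfig.exists_eq_rev_val hkm
    exact ⟨i, by simpa using hk i.rev, fun l hl => by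
      rw [hk, if_neg (fun he => hl (Fin.rev_injective (Fin.ext he))), add_zero]⟩
  let c : WalkerConfig m n :=
    { pos := fun t i => (i : ℤ) + 1 + g t i.rev
      start := fun j => by simp [hg.1]
      finish := fun j => by simp [hg.2.1]
      vicious := fun t i j hij => by
        have h1 : g t i.rev ≤ g t j.rev := hg.2.2.1 t (Fin.rev_le_rev.2 hij.le)
        have h2 : i.val < j.val := hij
        simp only
        omega
      wall := fun t j => by omega
      step := fun t => by
        obtain ⟨k, hk | hk⟩ := hg.2.2.2 t
        · obtain ⟨i, hi, hl⟩ := hsingle _ _ k hk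
          exact ⟨i, Or.inl (by rw [hi]; push_cast; ring), fun l hli => by rw [hl l hli]⟩
        · obtain ⟨i, hi, hl⟩ := hsingle _ _ k hk
          exact ⟨i, Or.inr (by rw [hi]; push_cast; ring), fun l hli => by rw [hl l hli]⟩ }
  refine ⟨c, fun t j => ?_⟩
  rcases lt_or_ge j m with h | h
  · obtain ⟨i, rfl⟩ := WalkerConfig.exists_eq_rev_val h
    rw [WalkerConfig.disp_of_lt]
    simp [c]
  · rw [WalkerConfig.disp_of_le c t h, hm' t j h, Nat.cast_zero]

/-! ### The two bijections -/

/-- A relation that is a bijection onto a subtype is given by an equivalence. -/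
lemma exists_equiv_of_rel {α β : Type*} {P : β → Prop} (R : α → β → Prop)
    (hex : ∀ a, ∃ b, R a b) (hP : ∀ a b, R a b → P b)
    (huniq : ∀ a b b', R a b → R a b' → b = b') (hsurj : ∀ b, P b → ∃ a, R a b)
    (hinj : ∀ a a' b, R a b → R a' b → a = a') :
    ∃ Φ : α ≃ {b // P b}, ∀ a b, R a b ↔ (Φ a : β) = b := by
  choose f hf using hex
  refine ⟨Equiv.ofBijective (fun a => ⟨f a, hP _ _ (hf a)⟩) ⟨fun a a' h => ?_, fun b => ?_⟩,
    fun a b => ⟨fun h => huniq _ _ _ (hf a) h, fun h => ?_⟩⟩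
  · have : f a = f a' := congrArg Subtype.val h
    exact hinj _ _ _ (hf a) (this ▸ hf a')
  · obtain ⟨a, ha⟩ := hsurj b.1 b.2
    exact ⟨a, Subtype.ext (huniq _ _ _ (hf a) ha)⟩
  · exact h ▸ hf a

/-- With walkers as rows, having `p` walkers means that no diagram has more than `p` rows, which is
the bound on the first column. -/
theorem exists_equiv_firstClass (N p : ℕ) :
    ∃ Φ : FirstClass N p ≃ BoundedInvolution N p,
      ∀ (c : FirstClass N p) (σ : Equiv.Perm (Fin (2 * N))),
        RowCorrespondence c σ ↔ (Φ c : Equiv.Perm (Fin (2 * N))) = σ := by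
  refine exists_equiv_of_rel _ (fun c => ?_) ?_ ?_ ?_ ?_
  · obtain ⟨g, hg, hcg⟩ := c.exists_isShapeWalk
    obtain ⟨f, hf, hfg⟩ := hg.exists_conj
    obtain ⟨T, σ, hT, hrun⟩ := hf.exists_isSundaramRun
    refine ⟨σ, T, fun t j => ?_, hrun⟩
    rw [hcg]
    refine congrArg _ (eq_of_forall_lt_iff fun i => ?_)
    rw [← (hrun.2.2.1 t).lt_colLen_iff, hT, hfg]
  · rintro c σ ⟨T, hT, hrun⟩
    refine ⟨hrun.isFixedPointFreeInvolution, (hrun.colLen_zero_le_iff p).1 fun t => ?_⟩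
    by_contra! hlt
    rw [(hrun.2.2.1 t).lt_colLen_iff] at hlt
    have := hT t p
    rw [c.disp_of_le t le_rfl] at this
    omega
  · rintro c σ σ' ⟨T, hT, hrun⟩ ⟨T', hT', hrun'⟩
    refine hrun.unique_perm hrun' fun t j => eq_of_forall_lt_iff fun i => ?_
    rw [(hrun.2.2.1 t).lt_colLen_iff, (hrun'.2.2.1 t).lt_colLen_iff]
    have h1 := hT t i
    have h2 := hT' t i
    omega
  · rintro σ ⟨hσ, hmax⟩
    obtain ⟨T, hrun⟩ := exists_isSundaramRun hσ
    obtain ⟨g, hg, hgT⟩ := hrun.colLen_isShapeWalk.exists_conj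
    have hrow : ∀ t j, (T t).rowLen j = g t j := fun t j => eq_of_forall_lt_iff fun i => by
      rw [hgT, (hrun.2.2.1 t).lt_colLen_iff]
    obtain ⟨c, hc⟩ := hg.exists_walkerConfig (m := p) fun t => by
      refine Nat.eq_zero_of_not_pos fun hp => ?_
      rw [hgT] at hp
      exact absurd ((hrun.colLen_zero_le_iff p).2 hmax t) hp.not_ge
    exact ⟨c, T, fun t j => by rw [hc, hrow], hrun⟩
  · rintro c c' σ ⟨T, hT, hrun⟩ ⟨T', hT', hrun'⟩
    obtain rfl := hrun.unique_tableau hrun'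
    exact WalkerConfig.ext_disp fun t j => by rw [← hT, ← hT']

/-- With walkers as columns, the right-most walker is the first column, so its displacement bound is
the bound sought, the absolute value being harmless for nonnegative displacements. -/
theorem exists_equiv_secondClass (N p : ℕ) {M : ℕ} (hM : N ≤ M) :
    ∃ Ψ : SecondClass N p M ≃ BoundedInvolution N p,
      ∀ (c : SecondClass N p M) (σ : Equiv.Perm (Fin (2 * N))),
        ColumnCorrespondence c.1 σ ↔ (Ψ c : Equiv.Perm (Fin (2 * N))) = σ := by
  refine exists_equiv_of_rel _ (fun c => ?_) ?_ ?_ ?_ ?_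
  · obtain ⟨f, hf, hcf⟩ := c.1.exists_isShapeWalk
    obtain ⟨T, σ, hT, hrun⟩ := hf.exists_isSundaramRun
    exact ⟨σ, T, fun t j => by rw [hcf, hT], hrun⟩
  · rintro ⟨c, hc⟩ σ ⟨T, hT, hrun⟩
    refine ⟨hrun.isFixedPointFreeInvolution, (hrun.colLen_zero_le_iff p).1 fun t => ?_⟩
    have h1 := (le_abs_self _).trans (hc t)
    rw [← hT t 0] at h1
    exact_mod_cast h1
  · rintro c σ σ' ⟨T, hT, hrun⟩ ⟨T', hT', hrun'⟩
    refine hrun.unique_perm hrun' fun t j => ?_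
    have h1 := hT t j
    have h2 := hT' t j
    omega
  · rintro σ ⟨hσ, hmax⟩
    obtain ⟨T, hrun⟩ := exists_isSundaramRun hσ
    -- No diagram has more than `N ≤ M` columns, so `M` walkers can carry the whole shape.
    obtain ⟨c, hc⟩ := hrun.colLen_isShapeWalk.exists_walkerConfig (m := M) fun t =>
      colLen_eq_zero_of_length_le (by have := hrun.two_mul_length_le t; omega)
    refine ⟨⟨c, fun t => ?_⟩, T, fun t j => (hc t j).symm, hrun⟩
    rw [hc, Nat.abs_cast]
    exact_mod_cast (hrun.colLen_zero_le_iff p).2 hmax t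
  · rintro c c' σ ⟨T, hT, hrun⟩ ⟨T', hT', hrun'⟩
    obtain rfl := hrun.unique_tableau hrun'
    exact Subtype.ext (WalkerConfig.ext_disp fun t j => by rw [← hT, ← hT'])

theorem proposition1 (N p : ℕ) :
    (∃ Φ : FirstClass N p ≃ BoundedInvolution N p,
      ∀ (c : FirstClass N p) (σ : Equiv.Perm (Fin (2 * N))),
        RowCorrespondence c σ ↔ (Φ c : Equiv.Perm (Fin (2 * N))) = σ) ∧
    (∀ M : ℕ, N ≤ M →
      ∃ Ψ : SecondClass N p M ≃ BoundedInvolution N p,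
        ∀ (c : SecondClass N p M) (σ : Equiv.Perm (Fin (2 * N))),
          ColumnCorrespondence c.1 σ ↔ (Ψ c : Equiv.Perm (Fin (2 * N))) = σ) :=
  ⟨exists_equiv_firstClass N p, fun _ hM => exists_equiv_secondClass N p hM⟩
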